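/- A plane partition is a finite set $P$ of points $(i,j,k)$ with positive integer coordinates (called cubes) such that $(i,j,k)\in P$ and $1\le i'\le i$, $1\le j'\le j$, $1\le k'\le k$ imply $(i',j',k')\in P$. It is contained in the $a\times b\times c$ box if $i\le a$, $j\le b$, $k\le c$ for all $(i,j,k)\in P$, and such a $P$ is called self-complementary if for all $1\le i\le a$, $1\le j\le b$, $1\le k\le c$ exactly one of $(i,j,k)$ and $(a+1-i,b+1-j,c+1-k)$ lies in $P$. Let $a,b,c$ be even nonnegative integers. For a self-complementary plane partition $P$ in the $a\times b\times c$ box let $n(P)$ be the number of cubes $(i,j,k)\in P$ which do not belong to the half-full plane partition $\{(i,j,k): 1\le i\le a/2,\ 1\le j\le b,\ 1\le k\le c\}$. Then $$\sum_{P}(-1)^{n(P)} = B\left(\frac a2,\frac b2,\frac c2\right),$$ where the sum is over all self-complementary plane partitions $P$ contained in the $a\times b\times c$ box, and $$B(a,b,c)=\prod_{i=1}^{a}\frac{(c+i)_b}{(i)_b},\qquad (x)_n=x(x+1)\cdots(x+n-1).$$ -/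

import Mathlib

/-- A plane partition: a finite set of points with positive integer coordinates (the cubes) which
with every point contains all points of the positive octant that are coordinatewise smaller. -/
def IsPlanePartition (P : Finset (ℕ × ℕ × ℕ)) : Prop :=
  (∀ i j k : ℕ, (i, j, k) ∈ P → 1 ≤ i ∧ 1 ≤ j ∧ 1 ≤ k) ∧
  (∀ i j k i' j' k' : ℕ, (i, j, k) ∈ P → 1 ≤ i' → i' ≤ i → 1 ≤ j' → j' ≤ j →
    1 ≤ k' → k' ≤ k → (i', j', k') ∈ P)

/-- The cubes of the box with sidelengths `a`, `b`, `c`. -/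
def cubeBox (a b c : ℕ) : Finset (ℕ × ℕ × ℕ) :=
  Finset.Icc 1 a ×ˢ Finset.Icc 1 b ×ˢ Finset.Icc 1 c

/-- Self-complementarity in the `a × b × c` box: of every cube of the box and its image under
the point reflection in the centre of the box, exactly one belongs to `P`. The subtractions are
exact, because `i ≤ a`, `j ≤ b`, `k ≤ c`. -/
def IsSelfComplementary (a b c : ℕ) (P : Finset (ℕ × ℕ × ℕ)) : Prop :=
  ∀ i j k : ℕ, (i, j, k) ∈ cubeBox a b c →
    ((i, j, k) ∈ P ↔ (a + 1 - i, b + 1 - j, c + 1 - k) ∉ P)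

open Classical in
/-- The finite set of all self-complementary plane partitions contained in the
`a × b × c` box. -/
noncomputable def selfCompPlanePartitions (a b c : ℕ) : Finset (Finset (ℕ × ℕ × ℕ)) :=
  (cubeBox a b c).powerset.filter
    (fun P => IsPlanePartition P ∧ IsSelfComplementary a b c P)

/-- The half-full plane partition, which is given the sign `+1`: all cubes of the box with first
coordinate at most `a / 2` (used for even `a`). -/
def halfFull (a b c : ℕ) : Finset (ℕ × ℕ × ℕ) :=
  (cubeBox a b c).filter (fun p => p.1 ≤ a / 2)

/-- The number of half orbits that are in `P` but not in the half-full plane partition. When `a`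
is even, an orbit of the point reflection consists of two different cubes, so that a half orbit is
a single cube. -/
def halfOrbitCount (a b c : ℕ) (P : Finset (ℕ × ℕ × ℕ)) : ℕ :=
  (P \ halfFull a b c).card

/-- The `(-1)`-enumeration of self-complementary plane partitions in the `a × b × c` box. -/
noncomputable def signedSelfCompEnum (a b c : ℕ) : ℤ :=
  ∑ P ∈ selfCompPlanePartitions a b c, (-1) ^ halfOrbitCount a b c P

/-- MacMahon's box formula `∏_{i=1}^{a} (c+i)_b / (i)_b`, where
`(x)_n = x (x+1) ⋯ (x+n-1)` is `Nat.ascFactorial x n`. -/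
def macMahonBox (a b c : ℕ) : ℚ :=
  ∏ i ∈ Finset.Icc 1 a, ((c + i).ascFactorial b : ℚ) / (i.ascFactorial b : ℚ)

/-! Write `a = 2α`, `b = 2β`, `c = 2γ` and `N = α + γ`. Cut `P` along the diagonals `i - k = const`.
The column heights along the successive diagonals are partitions in the `a × b` rectangle; they grow
by horizontal strips from the empty to the full one, and self-complementarity says that the point
reflection reverses this chain. Hence `P` amounts to a chain of `N` steps from the empty partition
to a self-complementary `ν`, the middle diagonal (`signedSelfCompEnum_eq_sum_chainSign`). As `b` is
even, reflected heights have the same parity, so the sign, a product over half of the rows of all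
diagonals, becomes a product over all rows of half of the diagonals (`prod_half_grid`): each
partition `μ` before `ν` contributes `(-1)^|μ|`, and `ν` contributes the sign of the sum of its
larger half.

With the weights `(-1)^|μ|`, the chains ending at `ν` sum to the Schur function `s_ν(1, -1, 1, …)`
in `N` variables, as a Jacobi–Trudi minor with rows `ν_r + r` of a Toeplitz matrix
(`signedChainSum_eq_det`). For self-complementary `ν` these rows form pairs with sum `2(α + β) - 1`,
hence one even and one odd row in each. Sorting rows and columns by parity splits the minor into two
minors of Toeplitz matrices of powers of `1 / (1 - X)` (`det_alternatingToeplitz_blocks`,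
`det_reflectedRow`). The sign of the sorting depends on `ν` exactly as the sign contributed by `ν`,
so the two cancel up to a constant.

Cauchy–Binet then sums the products over all `ν` to one determinant (`sum_strictMono_det_mul_det`):
Jacobi–Trudi for the `α × β` rectangle in `α + γ` variables equal to `1`, which is evaluated by a
Vandermonde determinant (`det_multichoose_eq_macMahonBox`). -/

/-! ### General tools: Cauchy–Binet, transfer operators, determinants of partial sums. -/

/-- The Cauchy–Binet formula, with the minors indexed by strictly increasing maps. -/
theorem det_transpose_mul_eq_sum_strictMono {R : Type*} [CommRing R] {m n : ℕ}
    (A B : Matrix (Fin n) (Fin m) R) :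
    (A.transpose * B).det =
      ∑ q : Fin m → Fin n with StrictMono q, (A.submatrix q id).det * (B.submatrix q id).det := by
  classical
  have h1 : (A.transpose * B).det =
      ∑ f : Fin m → Fin n, (∏ i, A (f i) i) * (B.submatrix f id).det := by
    have : (A.transpose * B) = fun i => ∑ k : Fin n, A k i • B k := by
      ext i j
      simp [Matrix.mul_apply, Finset.sum_apply]
    rw [this]
    change Matrix.detRowAlternating.toMultilinearMap
      (fun i => ∑ k ∈ Finset.univ, A k i • B k) = _
    rw [MultilinearMap.map_sum_finset]
    rw [Fintype.piFinset_univ]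
    refine Finset.sum_congr rfl fun f _ => ?_
    rw [MultilinearMap.map_smul_univ]
    rfl
  have h2 : ∑ f : Fin m → Fin n, (∏ i, A (f i) i) * (B.submatrix f id).det =
      ∑ f : Fin m → Fin n with Function.Injective f,
        (∏ i, A (f i) i) * (B.submatrix f id).det := by
    rw [Finset.sum_filter]
    refine Finset.sum_congr rfl fun f _ => ?_
    split_ifs with hf
    · rfl
    · rw [Function.Injective] at hf
      push Not at hf
      obtain ⟨i, j, hij, hne⟩ := hf
      rw [Matrix.det_zero_of_row_eq hne, mul_zero]
      ext k
      simp [hij]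
  rw [h1, h2]
  have h3 : ∀ q : Fin m → Fin n, (A.submatrix q id).det * (B.submatrix q id).det =
      ∑ σ : Equiv.Perm (Fin m),
        (∏ i, A (q (σ i)) i) * (B.submatrix (q ∘ σ) id).det := by
    intro q
    rw [Matrix.det_apply', Finset.sum_mul]
    refine Finset.sum_congr rfl fun σ _ => ?_
    have : (B.submatrix (q ∘ σ) id) = (B.submatrix q id).submatrix σ id := rfl
    rw [this, Matrix.det_permute]
    simp only [Matrix.submatrix_apply, id]
    ring
  simp_rw [h3]
  rw [Finset.sum_sigma']
  symm
  refine Finset.sum_bij (fun x _ => x.1 ∘ x.2) ?_ ?_ ?_ ?_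
  · rintro ⟨q, σ⟩ h
    simp only [Finset.mem_sigma, Finset.mem_filter, Finset.mem_univ, true_and, and_true] at h
    simpa using h.injective
  · rintro ⟨q, σ⟩ h ⟨q', σ'⟩ h' e
    simp only [Finset.mem_sigma, Finset.mem_filter, Finset.mem_univ, true_and, and_true] at h h' e
    have hq : q = q' := by
      refine StrictMono.range_inj h h' |>.mp ?_
      have := congrArg Set.range e
      simpa [Set.range_comp] using this
    subst hq
    have : σ = σ' := by
      ext i
      exact congrArg Fin.val (h.injective (congrFun e i))
    rw [this]
  · intro f hf
    simp only [Finset.mem_filter, Finset.mem_univ, true_and] at hf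
    -- An injective index map is uniquely its sorted version followed by a permutation.
    refine ⟨⟨f ∘ Tuple.sort f, (Tuple.sort f)⁻¹⟩, ?_, ?_⟩
    · simp only [Finset.mem_sigma, Finset.mem_filter, Finset.mem_univ, true_and, and_true]
      exact (Tuple.monotone_sort f).strictMono_of_injective
        (hf.comp (Tuple.sort f).injective)
    · ext i
      simp
  · rintro ⟨q, σ⟩ h
    rfl

/-- Iterating a transfer operator is summing over paths. -/
theorem sum_paths_eq_sum_iterate {X R : Type*} [Fintype X] [CommRing R] (T : X → X → R)
    (D : ℕ → X → R) (hD : ∀ t y, D (t + 1) y = ∑ x, T x y * D t x) (N : ℕ) (g : X → R) :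
    ∑ S : Fin (N + 1) → X,
        g (S (Fin.last N)) * (D 0 (S 0) * ∏ s : Fin N, T (S s.castSucc) (S s.succ)) =
      ∑ y, g y * D N y := by
  induction N generalizing g with
  | zero =>
    refine Fintype.sum_equiv (Equiv.funUnique (Fin 1) X) _ _ fun S => ?_
    simp
  | succ N ih =>
    rw [← (Fin.snocEquiv (fun _ => X)).sum_comp, Fintype.sum_prod_type_right]
    -- The last step of the path is absorbed into the weight of the endpoint.
    have := ih (fun x => ∑ y, g y * T x y)
    calc _ = ∑ S : Fin (N + 1) → X, (∑ y, g y * T (S (Fin.last N)) y) *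
          (D 0 (S 0) * ∏ s : Fin N, T (S s.castSucc) (S s.succ)) := by
          refine Finset.sum_congr rfl fun S _ => ?_
          rw [Finset.sum_mul]
          refine Finset.sum_congr rfl fun y _ => ?_
          simp only [Fin.snocEquiv, Equiv.coe_fn_mk]
          rw [Fin.prod_univ_castSucc]
          have h0 : (Fin.snoc (α := fun _ => X) S y : Fin (N + 2) → X) 0 = S 0 := by
            rw [← Fin.castSucc_zero, Fin.snoc_castSucc]
          have h1 : ∀ i : Fin N, (Fin.snoc (α := fun _ => X) S y : Fin (N + 2) → X)
              i.castSucc.succ = S i.succ := by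
            intro i
            rw [Fin.succ_castSucc, Fin.snoc_castSucc]
          simp only [Fin.snoc_last, Fin.snoc_castSucc, h0, h1, Fin.succ_last]
          ring
      _ = _ := by
          rw [this]
          simp_rw [hD, Finset.sum_mul, Finset.mul_sum]
          rw [Finset.sum_comm]
          refine Finset.sum_congr rfl fun y _ => Finset.sum_congr rfl fun x _ => ?_
          ring

/-- A determinant whose rows are partial sums of a sequence of vectors is a sum over interlacing
index vectors. -/
theorem det_partialSum_rows {R : Type*} [CommRing R] {a : ℕ} (u : ℕ → Fin a → R)
    (l lo : Fin a → ℕ) (h0 : ∀ i : Fin a, i.val = 0 → lo i = 0)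
    (hlo : ∀ i j : Fin a, i.val + 1 = j.val → lo j = l i + 1) (hle : ∀ i, lo i ≤ l i + 1) :
    Matrix.det (fun i => ∑ m ∈ Finset.range (l i + 1), u m) =
      ∑ m ∈ Fintype.piFinset (fun i => Finset.Ico (lo i) (l i + 1)),
        Matrix.det (fun i => u (m i)) := by
  -- Subtracting from each row its predecessor leaves sums over the disjoint intervals between
  -- consecutive bounds; multilinearity then expands them.
  have key : Matrix.det (fun i => ∑ m ∈ Finset.range (l i + 1), u m) =
      Matrix.det (fun i => ∑ m ∈ Finset.Ico (lo i) (l i + 1), u m) := by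
    cases a with
    | zero => exact congrArg Matrix.det (funext fun i => i.elim0)
    | succ n =>
      refine Matrix.det_eq_of_forall_row_eq_smul_add_pred (fun _ => 1) ?_ ?_
      · intro j
        rw [h0 0 rfl, Nat.Ico_zero_eq_range]
      · intro i j
        have := Finset.sum_range_add_sum_Ico u (hle i.succ)
        rw [← this, hlo i.castSucc i.succ (by simp)]
        simp [add_comm]
  rw [key]
  exact MultilinearMap.map_sum_finset (Matrix.detRowAlternating.toMultilinearMap)
    (fun _ m => u m) _

/-! ### Signed chains as Toeplitz determinants. -/

/-- The coefficients of `(1 - X ^ 2) ^ (-t / 2)` for even `t` and of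
`(1 + X) * (1 - X ^ 2) ^ (-(t + 1) / 2)` for odd `t`. -/
def alternatingCoeff (t k : ℕ) : ℤ :=
  if t % 2 = 0 then (if k % 2 = 0 then (Nat.multichoose (t / 2) (k / 2) : ℤ) else 0)
  else (Nat.multichoose (t / 2 + 1) (k / 2) : ℤ)

theorem alternatingCoeff_succ_zero (t : ℕ) :
    alternatingCoeff (t + 1) 0 = alternatingCoeff t 0 := by
  simp [alternatingCoeff]

/-- The generating function `F_t` is that of the complete homogeneous functions in `t` variables `1,
-1, 1, …`. Negating all variables and adjoining a new variable `1` gives `(1 - X) F_{t+1}(X) =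
F_t(-X)`, of which this is a coefficient. -/
theorem alternatingCoeff_succ_succ (t k : ℕ) :
    alternatingCoeff (t + 1) (k + 1) =
      alternatingCoeff (t + 1) k + (-1) ^ (k + 1) * alternatingCoeff t (k + 1) := by
  obtain ⟨s, rfl | rfl⟩ := Nat.even_or_odd' t <;> obtain ⟨j, rfl | rfl⟩ := Nat.even_or_odd' k
  · have h1 : (2 * s + 1) % 2 = 1 := by omega
    have h2 : (2 * j + 1) / 2 = j := by omega
    have h3 : (2 * j + 1) % 2 = 1 := by omega
    simp [alternatingCoeff, h1, h2, h3]
  · have h1 : (2 * s + 1) % 2 = 1 := by omega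
    have h2 : (2 * j + 1) / 2 = j := by omega
    have h3 : (2 * j + 1 + 1) % 2 = 0 := by omega
    have h4 : (2 * j + 1 + 1) / 2 = j + 1 := by omega
    have h5 : (2 * s + 1) / 2 = s := by omega
    have h6 : Even (2 * j + 1 + 1) := by rw [Nat.even_iff]; exact h3
    simp [alternatingCoeff, h1, h2, h3, h4, h5, h6.neg_one_pow, Nat.multichoose_succ_succ]
    ring
  · have h1 : (2 * s + 1) % 2 = 1 := by omega
    have h2 : (2 * j + 1) / 2 = j := by omega
    have h3 : (2 * j + 1) % 2 = 1 := by omega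
    have h4 : (2 * s + 1 + 1) % 2 = 0 := by omega
    have h5 : (2 * s + 1) / 2 = s := by omega
    have h6 : (2 * s + 1 + 1) / 2 = s + 1 := by omega
    have h7 : Odd (2 * j + 1) := by rw [Nat.odd_iff]; exact h3
    simp [alternatingCoeff, h1, h2, h3, h4, h5, h6, h7.neg_one_pow]
  · have h1 : (2 * s + 1) % 2 = 1 := by omega
    have h2 : (2 * j + 1 + 1) / 2 = j + 1 := by omega
    have h3 : (2 * j + 1) % 2 = 1 := by omega
    have h4 : (2 * s + 1 + 1) % 2 = 0 := by omega
    have h5 : (2 * s + 1) / 2 = s := by omega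
    have h6 : (2 * s + 1 + 1) / 2 = s + 1 := by omega
    have h8 : (2 * j + 1 + 1) % 2 = 0 := by omega
    have h7 : Even (2 * j + 1 + 1) := by rw [Nat.even_iff]; exact h8
    simp [alternatingCoeff, h1, h2, h3, h4, h5, h6, h8, h7.neg_one_pow]

/-- The lower triangular Toeplitz matrix of the sequence `alternatingCoeff t`. -/
def alternatingToeplitz (t l c : ℕ) : ℤ := if c ≤ l then alternatingCoeff t (l - c) else 0

/-- Division by `1 - X` is partial summation, so each row at time `t + 1` is a partial sum of
sign-twisted rows at time `t`. This is the form that `det_partialSum_rows` needs. -/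
theorem alternatingToeplitz_succ (t l c : ℕ) :
    alternatingToeplitz (t + 1) l c =
      ∑ m ∈ Finset.range (l + 1), (-1) ^ (m + c) * alternatingToeplitz t m c := by
  induction l with
  | zero =>
    rcases Nat.eq_zero_or_pos c with rfl | hc
    · simp [alternatingToeplitz, alternatingCoeff_succ_zero]
    · simp [alternatingToeplitz, hc.ne']
  | succ l ih =>
    rw [Finset.sum_range_succ, ← ih]
    rcases lt_trichotomy c (l + 1) with h | h | h
    · obtain ⟨k, rfl⟩ := Nat.exists_eq_add_of_le (Nat.lt_succ_iff.mp h)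
      have e1 : c + k + 1 - c = k + 1 := by omega
      have e2 : c + k - c = k := by omega
      have e3 : (-1 : ℤ) ^ (c + k + 1 + c) = (-1) ^ (k + 1) := by
        rw [show c + k + 1 + c = 2 * c + (k + 1) by ring, pow_add, pow_mul]; simp
      simp [alternatingToeplitz, h.le, e1, e2, e3, alternatingCoeff_succ_succ]
    · subst h
      have : (-1 : ℤ) ^ (l + 1 + (l + 1)) = 1 := Even.neg_one_pow ⟨l + 1, rfl⟩
      simp [alternatingToeplitz, alternatingCoeff_succ_zero, this]
    · simp [alternatingToeplitz, h.not_ge, show ¬ c ≤ l by omega]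

/-- `μ` and `ν` are the row lengths, in increasing order, of two partitions inside the `a × b`
rectangle that differ by a horizontal strip. -/
def Interlaces {a b : ℕ} (μ ν : Fin a → Fin (b + 1)) : Prop :=
  (∀ i, μ i ≤ ν i) ∧ ∀ i j : Fin a, i.val + 1 = j.val → ν i ≤ μ j

open Classical in
/-- The sign of a step in a chain of interlacing partitions. -/
noncomputable def stepSign {a b : ℕ} (μ ν : Fin a → Fin (b + 1)) : ℤ :=
  if Interlaces μ ν then (-1) ^ (∑ i, (μ i).val) else 0

/-- The signed count of the chains of `t` steps that lead from the empty partition to `ν`. -/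
noncomputable def signedChainSum (a b : ℕ) : ℕ → (Fin a → Fin (b + 1)) → ℤ
  | 0, ν => if ν = 0 then 1 else 0
  | t + 1, ν => ∑ μ, stepSign μ ν * signedChainSum a b t μ

theorem det_alternatingToeplitz_zero {a b : ℕ} (ν : Fin a → Fin (b + 1)) (hν : Monotone ν) :
    Matrix.det (fun i c : Fin a => alternatingToeplitz 0 ((ν i).val + i.val) c.val) =
      if ν = 0 then 1 else 0 := by
  have hc : ∀ k, alternatingCoeff 0 k = if k = 0 then 1 else 0 := by
    intro k
    simp only [alternatingCoeff]
    rcases k with _ | _ | k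
    · simp
    · simp
    · simp [show (k + 1 + 1) / 2 = k / 2 + 1 by omega]
  split_ifs with h
  · subst h
    have : (fun i c : Fin a => alternatingToeplitz 0 (((0 : Fin a → Fin (b + 1)) i).val + i.val)
        c.val) = (1 : Matrix (Fin a) (Fin a) ℤ) := by
      ext i c
      simp only [alternatingToeplitz, hc, Matrix.one_apply, Pi.zero_apply, Fin.val_zero, zero_add,
        Fin.ext_iff]
      split_ifs <;> first | rfl | omega
    rw [this, Matrix.det_one]
  · obtain ⟨i, hi⟩ := Function.ne_iff.mp h
    have ha : 0 < a := i.pos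
    let last : Fin a := ⟨a - 1, by omega⟩
    -- If `ν ≠ 0`, its largest entry is positive, so the last row index is at least `a` and misses
    -- every column of the identity pattern.
    refine Matrix.det_eq_zero_of_row_eq_zero last fun c => ?_
    have h1 : ν i ≤ ν last := hν (by rw [Fin.le_def]; simp only [last]; omega)
    have h2 : 0 < (ν i).val := Nat.pos_of_ne_zero fun h' => hi (Fin.ext h')
    have h3 : (ν i).val ≤ (ν last).val := h1
    have h4 : last.val = a - 1 := rfl
    simp only [alternatingToeplitz, hc]
    split_ifs <;> first | rfl | omega

/-- With the shifted indices `m i = μ i + i` and `l i = ν i + i`, the interlacing of `μ` and `ν`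
reads `l (i - 1) < m i ≤ l i`, which is the index range produced by `det_partialSum_rows`. -/
theorem signedChainSum_eq_det {a b : ℕ} (t : ℕ) (ν : Fin a → Fin (b + 1)) (hν : Monotone ν) :
    signedChainSum a b t ν =
      Matrix.det (fun i c : Fin a => alternatingToeplitz t ((ν i).val + i.val) c.val) := by
  classical
  induction t generalizing ν with
  | zero => rw [signedChainSum, det_alternatingToeplitz_zero ν hν]
  | succ t ih =>
    let l : Fin a → ℕ := fun i => (ν i).val + i.val
    let lo : Fin a → ℕ := fun i =>
      if h : i.val = 0 then 0 else l ⟨i.val - 1, by omega⟩ + 1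
    have h0 : ∀ i : Fin a, i.val = 0 → lo i = 0 := fun i h => dif_pos h
    have hlo : ∀ i j : Fin a, i.val + 1 = j.val → lo j = l i + 1 := by
      intro i j h
      have : j.val ≠ 0 := by omega
      simp only [lo, dif_neg this]
      congr 2
      ext
      simp only
      omega
    have hmono : ∀ i j : Fin a, i.val + 1 = j.val → (ν i).val ≤ (ν j).val := fun i j h =>
      hν (by rw [Fin.le_def]; omega)
    have hle : ∀ i, lo i ≤ l i + 1 := by
      intro i
      by_cases h : i.val = 0
      · rw [h0 i h]; omega
      · have h' : (⟨i.val - 1, by omega⟩ : Fin a).val + 1 = i.val := by simp only; omega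
        rw [hlo _ i h']
        have := hmono _ i h'
        simp only [l] at *
        omega
    let u : ℕ → Fin a → ℤ := fun m c => (-1) ^ (m + c.val) * alternatingToeplitz t m c
    have key := det_partialSum_rows u l lo h0 hlo hle
    have e1 : (fun i => ∑ m ∈ Finset.range (l i + 1), u m) =
        fun i c : Fin a => alternatingToeplitz (t + 1) ((ν i).val + i.val) c.val := by
      ext i c
      rw [alternatingToeplitz_succ, Finset.sum_apply]
    rw [e1] at key
    rw [key, signedChainSum]
    -- The twist `(-1)^(m + c)` leaves the determinant row by row and column by column. The shift by
    -- `i` in `m i` cancels against the sum of the columns, so that `(-1)^|μ|` remains.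
    have e2 : ∀ m : Fin a → ℕ, Matrix.det (fun i => u (m i)) =
        (-1) ^ (∑ i, m i + ∑ c : Fin a, c.val) *
          Matrix.det (fun i c : Fin a => alternatingToeplitz t (m i) c) := by
      intro m
      have := Matrix.det_mul_column (fun i => (-1 : ℤ) ^ (m i))
        (Matrix.of fun i c : Fin a => (-1) ^ c.val * alternatingToeplitz t (m i) c)
      have h' := Matrix.det_mul_row (fun c : Fin a => (-1 : ℤ) ^ c.val)
        (Matrix.of fun i c : Fin a => alternatingToeplitz t (m i) c)
      simp only [Matrix.of_apply] at this h'
      rw [h', Finset.prod_pow_eq_pow_sum, Finset.prod_pow_eq_pow_sum, ← mul_assoc, ← pow_add]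
        at this
      refine Eq.trans ?_ this
      congr 1
      ext i c
      simp only [u, Matrix.of_apply, pow_add]
      ring
    simp_rw [e2]
    have e3 : ∑ μ, stepSign μ ν * signedChainSum a b t μ =
        ∑ μ with Interlaces μ ν, stepSign μ ν * signedChainSum a b t μ := by
      rw [Finset.sum_filter]
      refine Finset.sum_congr rfl fun μ _ => ?_
      by_cases h : Interlaces μ ν <;> simp [stepSign, h]
    rw [e3]
    refine Finset.sum_bij (fun μ _ i => (μ i).val + i.val) ?_ ?_ ?_ ?_
    · intro μ h
      simp only [Finset.mem_filter, Finset.mem_univ, true_and] at h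
      rw [Fintype.mem_piFinset]
      intro i
      rw [Finset.mem_Ico]
      have h1 : (μ i).val ≤ (ν i).val := h.1 i
      refine ⟨?_, by simp only [l]; omega⟩
      by_cases hi : i.val = 0
      · rw [h0 i hi]; omega
      · have h' : (⟨i.val - 1, by omega⟩ : Fin a).val + 1 = i.val := by simp only; omega
        rw [hlo _ i h']
        have h2 : (ν _).val ≤ (μ i).val := h.2 _ i h'
        simp only [l]
        omega
    · intro μ _ μ' _ e
      ext i
      have : (μ i).val + i.val = (μ' i).val + i.val := congrFun e i
      omega
    · intro m hm
      rw [Fintype.mem_piFinset] at hm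
      simp only [Finset.mem_Ico] at hm
      have hge : ∀ i : Fin a, i.val ≤ m i := by
        intro i
        by_cases hi : i.val = 0
        · omega
        · have h' : (⟨i.val - 1, by omega⟩ : Fin a).val + 1 = i.val := by simp only; omega
          have h2 := (hm i).1
          rw [hlo _ i h'] at h2
          simp only [l] at h2
          omega
      have hub : ∀ i : Fin a, m i - i.val ≤ (ν i).val := by
        intro i
        have := (hm i).2
        simp only [l] at this
        omega
      refine ⟨fun i => ⟨m i - i.val, by have := hub i; have := (ν i).isLt; omega⟩, ?_, ?_⟩
      · simp only [Finset.mem_filter, Finset.mem_univ, true_and]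
        refine ⟨fun i => ?_, fun i j hij => ?_⟩
        · exact hub i
        · rw [Fin.le_def]
          have h2 := (hm j).1
          rw [hlo i j hij] at h2
          simp only [l] at h2 ⊢
          omega
      · ext i
        have := hge i
        simp only
        omega
    · intro μ h
      simp only [Finset.mem_filter, Finset.mem_univ, true_and] at h
      have hμ : Monotone μ := by
        cases a with
        | zero => exact fun i => i.elim0
        | succ a =>
          refine Fin.monotone_iff_le_succ.mpr fun i => ?_
          exact (h.1 i.castSucc).trans (h.2 i.castSucc i.succ (by simp))
      rw [ih μ hμ, stepSign, if_pos h, Finset.sum_add_distrib, add_assoc, pow_add, pow_add,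
        ← mul_pow]
      simp

/-! ### The box formula as a determinant. -/

/-- The complete homogeneous symmetric function of degree `k` in `n` variables, evaluated at
`1, …, 1`; it is zero in negative degree. -/
def intMultichoose (n : ℕ) (k : ℤ) : ℤ := if 0 ≤ k then (Nat.multichoose n k.toNat : ℤ) else 0

theorem fwdDiff_intMultichoose (n : ℕ) (k : ℤ) :
    fwdDiff 1 (intMultichoose (n + 1)) k = intMultichoose n (k + 1) := by
  rw [fwdDiff]
  rcases lt_trichotomy k (-1) with h | rfl | h
  · simp [intMultichoose, show ¬ (0 ≤ k + 1) by omega, show ¬ (0 ≤ k) by omega]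
  · simp [intMultichoose]
  · obtain ⟨m, rfl⟩ := Int.eq_ofNat_of_zero_le (show 0 ≤ k by omega)
    have h1 : ((m : ℤ) + 1).toNat = m + 1 := by omega
    have h2 : (0 : ℤ) ≤ m + 1 := by omega
    simp [intMultichoose, h1, h2, Nat.multichoose_succ_succ]

theorem fwdDiff_iter_intMultichoose {N j : ℕ} (h : j ≤ N) (k : ℤ) :
    (fwdDiff 1)^[j] (intMultichoose N) k = intMultichoose (N - j) (k + j) := by
  induction j generalizing k with
  | zero => simp
  | succ j ih =>
    have e : (fwdDiff 1)^[j] (intMultichoose N) = fun k => intMultichoose (N - j) (k + j) :=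
      funext fun k => ih (by omega) k
    rw [Function.iterate_succ_apply', e]
    obtain ⟨M, hM⟩ : ∃ M, N - j = M + 1 := ⟨N - j - 1, by omega⟩
    have hM' : N - (j + 1) = M := by omega
    have := fwdDiff_intMultichoose M (k + j)
    rw [fwdDiff] at this ⊢
    rw [hM, hM']
    push_cast
    rw [← add_assoc, ← this]
    ring_nf

/-- Column `j` is replaced by the `j`-th forward difference of the columns `0, …, j`. This is a
unitriangular column operation, and each difference removes one variable. -/
theorem det_multichoose_eq_det_reduced (α β N : ℕ) (h : α ≤ N) :
    Matrix.det (fun i j : Fin α => intMultichoose N (β - i + j)) =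
      Matrix.det (fun i j : Fin α => intMultichoose (N - j) (β - i + j)) := by
  let U : Matrix (Fin α) (Fin α) ℤ := fun m j => (-1) ^ (j.val - m.val) * (j.val.choose m.val : ℤ)
  have hU : U.det = 1 := by
    rw [Matrix.det_of_isUpperTriangular]
    · simp [U]
    · intro i j hij
      have : j.val < i.val := hij
      simp [U, Nat.choose_eq_zero_of_lt this]
  have hmul : (Matrix.of fun i j : Fin α => intMultichoose (N - j) (β - i + j)) =
      (Matrix.of fun i j : Fin α => intMultichoose N (β - i + j)) * U := by
    ext i j
    rw [Matrix.of_apply, ← fwdDiff_iter_intMultichoose (by omega), fwdDiff_iter_eq_sum_shift,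
      Matrix.mul_apply]
    have hsub : Finset.range (j.val + 1) ⊆ Finset.range α := by
      intro x hx
      simp only [Finset.mem_range] at *
      omega
    rw [Finset.sum_subset hsub]
    · rw [Finset.sum_range]
      refine Finset.sum_congr rfl fun m _ => ?_
      simp [U, mul_comm]
    · intro x _ hx
      rw [Finset.mem_range, not_lt] at hx
      simp [Nat.choose_eq_zero_of_lt (show j.val < x by omega)]
  have := congrArg Matrix.det hmul
  rw [Matrix.det_mul, hU, mul_one] at this
  exact this.symm

/-- In the reduced matrix the numerator factorial of the binomial coefficient depends on the row
only. Clearing row and column factors therefore leaves a falling factorial, which also vanishes when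
the degree is negative. -/
theorem intMultichoose_mul_factorial {α N : ℕ} (β : ℕ) (h : α ≤ N) (i j : Fin α) :
    intMultichoose (N - j) (β - i + j) * ((N - 1 - j).factorial * (β + α - 1 - i).factorial : ℕ) =
      ((N - 1 + β - i).factorial * (β + α - 1 - i).descFactorial (α - 1 - j) : ℕ) := by
  have hi := i.isLt
  have hj := j.isLt
  by_cases hk : i.val ≤ β + j.val
  · obtain ⟨k, hk'⟩ := Nat.exists_eq_add_of_le hk
    have e1 : (β : ℤ) - i + j = k := by omega
    have e2 : (0 : ℤ) ≤ k := by omega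
    rw [intMultichoose, e1, if_pos e2, Int.toNat_natCast, Nat.multichoose_eq]
    norm_cast
    have e3 : N - j + k - 1 = (N - 1 - j) + k := by omega
    have e4 : N - 1 + β - i = (N - 1 - j) + k := by omega
    have e5 : β + α - 1 - i = k + (α - 1 - j) := by omega
    rw [e3, e4, e5, Nat.add_descFactorial_eq_ascFactorial,
      ← Nat.factorial_mul_ascFactorial k, ← Nat.add_choose_mul_factorial_mul_factorial]
    ring
  · have e1 : ¬ (0 : ℤ) ≤ (β : ℤ) - i + j := by omega
    rw [intMultichoose, if_neg e1, Nat.descFactorial_of_lt (by omega)]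
    simp

/-- After reversal of rows and columns the entries are monic polynomials of degree `j` at the
consecutive points `β + i`, so the determinant is a Vandermonde determinant. -/
theorem det_descFactorial (α β : ℕ) :
    Matrix.det (fun i j : Fin α => (((β + α - 1 - i).descFactorial (α - 1 - j) : ℕ) : ℤ)) =
      ∏ i ∈ Finset.range α, (i.factorial : ℤ) := by
  cases α with
  | zero => exact Matrix.det_fin_zero.trans (by simp)
  | succ n =>
    have h1 : Matrix.det (fun i j : Fin (n + 1) =>
        (((β + (n + 1) - 1 - i).descFactorial (n + 1 - 1 - j) : ℕ) : ℤ)) =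
        Matrix.det (Matrix.of fun i j : Fin (n + 1) =>
          (descPochhammer ℤ j).eval (((i.val : ℤ) + β))) := by
      rw [← Matrix.det_submatrix_equiv_self Fin.revPerm]
      congr 1
      ext i j
      have hi := i.isLt
      have hj := j.isLt
      simp only [Matrix.submatrix_apply, Fin.revPerm_apply, Fin.val_rev, Matrix.of_apply]
      rw [← Nat.cast_add, descPochhammer_eval_eq_descFactorial]
      congr 2 <;> omega
    rw [h1, ← Matrix.det_eval_matrixOfPolynomials_eq_det_vandermonde
      (fun i : Fin (n + 1) => (i.val : ℤ) + β) (fun j => descPochhammer ℤ j)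
      (fun i => descPochhammer_natDegree ℤ i) (fun i => monic_descPochhammer ℤ i),
      Matrix.det_vandermonde_add, Matrix.det_vandermonde_id_eq_superFactorial,
      ← Nat.prod_range_succ_factorial]
    push_cast
    rfl

theorem macMahonBox_mul_prod_factorial (α β γ : ℕ) :
    macMahonBox α β γ * ∏ i ∈ Finset.range α, (((γ + i).factorial : ℚ) * (β + i).factorial) =
      ∏ i ∈ Finset.range α, (((γ + β + i).factorial : ℚ) * i.factorial) := by
  have h : macMahonBox α β γ = ∏ i ∈ Finset.range α,
      (((γ + (i + 1)).ascFactorial β : ℚ) / ((i + 1).ascFactorial β : ℚ)) := by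
    rw [macMahonBox, ← Finset.Ico_add_one_right_eq_Icc, Finset.prod_Ico_eq_prod_range]
    refine Finset.prod_congr (by simp) fun i _ => ?_
    rw [add_comm 1 i]
  rw [h, ← Finset.prod_mul_distrib]
  refine Finset.prod_congr rfl fun i _ => ?_
  have h1 := Nat.factorial_mul_ascFactorial (γ + i) β
  have h2 := Nat.factorial_mul_ascFactorial i β
  rw [show γ + β + i = γ + i + β by ring, show β + i = i + β by ring, ← h1, ← h2]
  have h3 : ((i + 1).ascFactorial β : ℚ) ≠ 0 := by
    exact_mod_cast (Nat.ascFactorial_pos i β).ne'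
  push_cast
  rw [← add_assoc]
  field_simp

/-- The product formula for the number of plane partitions in a box, as the Jacobi–Trudi
determinant of a rectangular shape. -/
theorem det_multichoose_eq_macMahonBox (α β γ : ℕ) :
    ((Matrix.det (fun i j : Fin α => intMultichoose (α + γ) (β - i + j)) : ℤ) : ℚ) =
      macMahonBox α β γ := by
  rw [det_multichoose_eq_det_reduced α β (α + γ) (by omega)]
  set K : Matrix (Fin α) (Fin α) ℤ := fun i j => intMultichoose (α + γ - j) (β - i + j) with hK
  have hr : ∀ f : ℕ → ℤ, ∏ i : Fin α, f (α - 1 - i.val) = ∏ i ∈ Finset.range α, f i := by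
    intro f
    rw [Finset.prod_range, ← Equiv.prod_comp Fin.revPerm]
    refine Finset.prod_congr rfl fun i _ => ?_
    have := i.isLt
    rw [Fin.revPerm_apply, Fin.val_rev]
    congr 1
    omega
  have key : K.det * ((∏ j ∈ Finset.range α, ((γ + j).factorial : ℤ)) *
      ∏ i ∈ Finset.range α, ((β + i).factorial : ℤ)) =
      (∏ i ∈ Finset.range α, ((γ + β + i).factorial : ℤ)) *
        ∏ i ∈ Finset.range α, (i.factorial : ℤ) := by
    rw [← det_descFactorial α β, ← hr, ← hr, ← hr]
    have h1 := Matrix.det_mul_column (fun i : Fin α => ((γ + β + (α - 1 - i.val)).factorial : ℤ))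
      (Matrix.of fun i j : Fin α => (((β + α - 1 - i).descFactorial (α - 1 - j) : ℕ) : ℤ))
    have h2 := Matrix.det_mul_row (fun j : Fin α => ((γ + (α - 1 - j.val)).factorial : ℤ)) K
    have h3 := Matrix.det_mul_column (fun i : Fin α => ((β + (α - 1 - i.val)).factorial : ℤ))
      (Matrix.of fun i j => ((γ + (α - 1 - j.val)).factorial : ℤ) * K i j)
    rw [h2] at h3
    refine Eq.trans ?_ (Eq.trans (h3.symm.trans ?_) h1)
    · ring
    · congr 1
      ext i j
      have hi := i.isLt
      have hj := j.isLt
      have := intMultichoose_mul_factorial β (show α ≤ α + γ by omega) i j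
      simp only [Matrix.of_apply]
      rw [show γ + β + (α - 1 - i.val) = α + γ - 1 + β - i by omega,
        show γ + (α - 1 - j.val) = α + γ - 1 - j by omega,
        show β + (α - 1 - i.val) = β + α - 1 - i by omega]
      push_cast at this
      rw [← this, hK]
      ring
  have hbox := macMahonBox_mul_prod_factorial α β γ
  have hne : (∏ i ∈ Finset.range α, (((γ + i).factorial : ℚ) * (β + i).factorial)) ≠ 0 := by
    refine Finset.prod_ne_zero_iff.mpr fun i _ => ?_
    positivity
  refine mul_right_cancel₀ hne ?_
  rw [hbox, Finset.prod_mul_distrib, Finset.prod_mul_distrib]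
  exact_mod_cast key

/-! ### Convolution of Toeplitz matrices and splitting by parity. -/

/-- The generating function of `Nat.multichoose s`. -/
def multichooseSeries (s : ℕ) : PowerSeries ℤ := PowerSeries.mk fun k => (Nat.multichoose s k : ℤ)

theorem one_sub_X_mul_multichooseSeries (s : ℕ) :
    (1 - PowerSeries.X) * multichooseSeries (s + 1) = multichooseSeries s := by
  ext k
  rw [sub_mul, one_mul, map_sub]
  cases k with
  | zero => simp [multichooseSeries]
  | succ k => simp [multichooseSeries, PowerSeries.coeff_succ_X_mul, Nat.multichoose_succ_succ]

theorem multichooseSeries_mul (s t : ℕ) :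
    multichooseSeries s * multichooseSeries t = multichooseSeries (s + t) := by
  induction s with
  | zero =>
    have : multichooseSeries 0 = 1 := by
      ext k
      cases k <;> simp [multichooseSeries, PowerSeries.coeff_one]
    rw [this, one_mul, zero_add]
  | succ s ih =>
    have h : (1 - PowerSeries.X : PowerSeries ℤ) ≠ 0 := by
      intro h
      have := congrArg (PowerSeries.coeff 0) h
      simp at this
    refine mul_left_cancel₀ h ?_
    rw [← mul_assoc, one_sub_X_mul_multichooseSeries, ih, show s + 1 + t = s + t + 1 by ring,
      one_sub_X_mul_multichooseSeries]

/-- The lower triangular Toeplitz matrix of the sequence `Nat.multichoose s`. -/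
def multichooseToeplitz (s m c : ℕ) : ℤ :=
  if c ≤ m then (Nat.multichoose s (m - c) : ℤ) else 0

theorem coeff_X_pow_mul_multichooseSeries (s m c : ℕ) :
    PowerSeries.coeff m (PowerSeries.X ^ c * multichooseSeries s) = multichooseToeplitz s m c := by
  rw [PowerSeries.coeff_X_pow_mul', multichooseToeplitz]
  simp [multichooseSeries]

/-- Both sides are the coefficient of `X^n` in `X^(c+d) / (1 - X)^(s+t)`. -/
theorem sum_multichooseToeplitz_mul (s t n c d : ℕ) :
    ∑ m ∈ Finset.range (n + 1), multichooseToeplitz s m c * multichooseToeplitz t (n - m) d =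
      intMultichoose (s + t) (n - c - d) := by
  simp_rw [← coeff_X_pow_mul_multichooseSeries]
  rw [← Finset.Nat.sum_antidiagonal_eq_sum_range_succ (fun i j =>
    PowerSeries.coeff i (PowerSeries.X ^ c * multichooseSeries s) *
    PowerSeries.coeff j (PowerSeries.X ^ d * multichooseSeries t)), ← PowerSeries.coeff_mul,
    show PowerSeries.X ^ c * multichooseSeries s * (PowerSeries.X ^ d * multichooseSeries t) =
      PowerSeries.X ^ (c + d) * (multichooseSeries s * multichooseSeries t) by ring,
    multichooseSeries_mul, coeff_X_pow_mul_multichooseSeries, multichooseToeplitz, intMultichoose]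
  by_cases h : c + d ≤ n
  · rw [if_pos h, if_pos (by omega), show ((n : ℤ) - c - d).toNat = n - (c + d) by omega]
  · rw [if_neg h, if_neg (by omega)]

/-- Sorting rows and columns by parity splits the Toeplitz determinant into two factors. -/
theorem det_alternatingToeplitz_blocks {α : ℕ} (N : ℕ) (e o : Fin α → ℕ) :
    (Matrix.fromBlocks
      (Matrix.of fun i c : Fin α => alternatingToeplitz N (2 * e i) (2 * c))
      (Matrix.of fun i c : Fin α => alternatingToeplitz N (2 * e i) (2 * c + 1))
      (Matrix.of fun i c : Fin α => alternatingToeplitz N (2 * o i + 1) (2 * c))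
      (Matrix.of fun i c : Fin α => alternatingToeplitz N (2 * o i + 1) (2 * c + 1))).det =
    (Matrix.of fun i c : Fin α => multichooseToeplitz (N / 2) (e i) c).det *
      (Matrix.of fun i c : Fin α => multichooseToeplitz (N - N / 2) (o i) c).det := by
  obtain ⟨s, rfl | rfl⟩ := Nat.even_or_odd' N
  · have hA : ∀ x c : ℕ, alternatingToeplitz (2 * s) (2 * x) (2 * c) =
        multichooseToeplitz s x c := by
      intro x c
      have h1 : (2 * x - 2 * c) % 2 = 0 := by omega
      have h2 : (2 * x - 2 * c) / 2 = x - c := by omega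
      simp [alternatingToeplitz, alternatingCoeff, multichooseToeplitz, h1, h2]
    -- For even `N` the series is even, so the even rows vanish in the odd columns and the matrix is
    -- block triangular.
    have hB : ∀ x c : ℕ, alternatingToeplitz (2 * s) (2 * x) (2 * c + 1) = 0 := by
      intro x c
      by_cases h : 2 * c + 1 ≤ 2 * x
      · have h1 : (2 * x - (2 * c + 1)) % 2 = 1 := by omega
        simp [alternatingToeplitz, alternatingCoeff, h1]
      · simp [alternatingToeplitz, h]
    have hD : ∀ x c : ℕ, alternatingToeplitz (2 * s) (2 * x + 1) (2 * c + 1) =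
        multichooseToeplitz s x c := by
      intro x c
      have h1 : (2 * x - 2 * c) % 2 = 0 := by omega
      have h2 : (2 * x - 2 * c) / 2 = x - c := by omega
      simp [alternatingToeplitz, alternatingCoeff, multichooseToeplitz, h1, h2]
    simp_rw [hA, hB, hD]
    have h0 : (Matrix.of fun _ _ : Fin α => (0 : ℤ)) = 0 := rfl
    rw [h0, Matrix.det_fromBlocks_zero₁₂, show 2 * s / 2 = s by omega,
      show 2 * s - s = s by omega]
  · have h3 : (2 * s + 1) % 2 = 1 := by omega
    have h4 : (2 * s + 1) / 2 = s := by omega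
    have hC : ∀ x c : ℕ, alternatingToeplitz (2 * s + 1) (2 * x + 1) (2 * c) =
        multichooseToeplitz (s + 1) x c := by
      intro x c
      by_cases h : c ≤ x
      · have h2 : (2 * x + 1 - 2 * c) / 2 = x - c := by omega
        have h5 : 2 * c ≤ 2 * x + 1 := by omega
        simp [alternatingToeplitz, alternatingCoeff, multichooseToeplitz, h2, h3, h4, h, h5]
      · have h5 : ¬ 2 * c ≤ 2 * x + 1 := by omega
        simp [alternatingToeplitz, multichooseToeplitz, h, h5]
    have hD : ∀ x c : ℕ, alternatingToeplitz (2 * s + 1) (2 * x + 1) (2 * c + 1) =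
        multichooseToeplitz (s + 1) x c := by
      intro x c
      have h2 : (2 * x - 2 * c) / 2 = x - c := by omega
      simp [alternatingToeplitz, alternatingCoeff, multichooseToeplitz, h2, h3, h4]
    -- For odd `N` the series is `(1 + X) G(X²)`, so the odd rows agree in the columns `2c` and `2c
    -- + 1`. Subtracting the odd columns from the even ones makes the matrix block triangular; in
    -- the even rows the difference multiplies `G` by `1 - X`, which lowers the exponent from `s +
    -- 1` to `s`.
    have hAB : ∀ x c : ℕ, alternatingToeplitz (2 * s + 1) (2 * x) (2 * c) -
        alternatingToeplitz (2 * s + 1) (2 * x) (2 * c + 1) = multichooseToeplitz s x c := by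
      intro x c
      rcases lt_trichotomy c x with h | rfl | h
      · obtain ⟨k, rfl⟩ := Nat.exists_eq_add_of_lt h
        have h1 : 2 * c ≤ 2 * (c + k + 1) := by omega
        have h2 : 2 * c + 1 ≤ 2 * (c + k + 1) := by omega
        have h5 : (2 * (c + k + 1) - 2 * c) / 2 = k + 1 := by omega
        have h6 : (2 * (c + k + 1) - (2 * c + 1)) / 2 = k := by omega
        have h7 : c + k + 1 - c = k + 1 := by omega
        rw [alternatingToeplitz, alternatingToeplitz, if_pos h1, if_pos h2, alternatingCoeff,
          alternatingCoeff, h3, h4, h5, h6, multichooseToeplitz, if_pos h.le, h7,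
          Nat.multichoose_succ_succ]
        simp
      · simp [alternatingToeplitz, alternatingCoeff, multichooseToeplitz, h3]
      · have h1 : ¬ 2 * c ≤ 2 * x := by omega
        have h2 : ¬ 2 * c + 1 ≤ 2 * x := by omega
        simp [alternatingToeplitz, multichooseToeplitz, h1, h2, h.not_ge]
    simp_rw [hC, hD]
    set A := Matrix.of fun i c : Fin α => alternatingToeplitz (2 * s + 1) (2 * e i) (2 * c)
    set B := Matrix.of fun i c : Fin α => alternatingToeplitz (2 * s + 1) (2 * e i) (2 * c + 1)
    set D := Matrix.of fun i c : Fin α => multichooseToeplitz (s + 1) (o i) c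
    have hm : Matrix.fromBlocks A B D D * Matrix.fromBlocks 1 0 (-1) 1 =
        Matrix.fromBlocks (A - B) B 0 D := by
      rw [Matrix.fromBlocks_multiply]
      simp [sub_eq_add_neg]
    have := congrArg Matrix.det hm
    rw [Matrix.det_mul, Matrix.det_fromBlocks_zero₁₂, Matrix.det_fromBlocks_zero₂₁, Matrix.det_one,
      mul_one, mul_one] at this
    rw [this, h4, show 2 * s + 1 - s = s + 1 by omega]
    congr 2
    ext i c
    simp [A, B, hAB]

/-! ### Summation over index sets by Cauchy–Binet. -/

/-- The half of the even member of the pair `{n + k, n - 1 - k}`. -/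
def evenHalf (n k : ℕ) : ℕ := if (n + k) % 2 = 0 then (n + k) / 2 else (n - 1 - k) / 2

theorem evenHalf_lt {n k : ℕ} (h : k < n) : evenHalf n k < n := by
  rw [evenHalf]
  split_ifs <;> omega

theorem evenHalf_injective {n k k' : ℕ} (h : k < n) (h' : k' < n)
    (e : evenHalf n k = evenHalf n k') : k = k' := by
  rw [evenHalf, evenHalf] at e
  split_ifs at e <;> omega

/-- An even number below `2n` determines its pair `{n + k, n - 1 - k}`, so `evenHalf n` permutes `0,
…, n - 1`. -/
theorem sum_comp_evenHalf {M : Type*} [AddCommMonoid M] (n : ℕ) (f : ℕ → M) :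
    ∑ k : Fin n, f (evenHalf n k) = ∑ m ∈ Finset.range n, f m := by
  rw [Finset.sum_range]
  have hinj : Function.Injective (fun k : Fin n => (⟨evenHalf n k, evenHalf_lt k.isLt⟩ : Fin n)) :=
    fun k k' e => Fin.ext (evenHalf_injective k.isLt k'.isLt (congrArg Fin.val e))
  exact (Finite.injective_iff_bijective.mp hinj).sum_comp (fun m : Fin n => f m)

/-- By Cauchy–Binet the sum is the determinant of the matrix of convolutions with entries of degree
`α + β - 1 - c - d`. Reversing the columns gives the Jacobi–Trudi form and the sign of
`Fin.revPerm`. -/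
theorem sum_strictMono_det_mul_det (α β s t : ℕ) :
    ∑ q : Fin α → Fin (α + β) with StrictMono q,
      (Matrix.of fun i c : Fin α =>
        multichooseToeplitz s (evenHalf (α + β) (q i)) c).det *
      (Matrix.of fun i c : Fin α =>
        multichooseToeplitz t (α + β - 1 - evenHalf (α + β) (q i)) c).det =
    ((Equiv.Perm.sign (Fin.revPerm : Equiv.Perm (Fin α)) : ℤˣ) : ℤ) *
      (Matrix.of fun i j : Fin α => intMultichoose (s + t) (β - i + j)).det := by
  set n := α + β with hn
  let A : Matrix (Fin n) (Fin α) ℤ := Matrix.of fun k c => multichooseToeplitz s (evenHalf n k) c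
  let B : Matrix (Fin n) (Fin α) ℤ :=
    Matrix.of fun k c => multichooseToeplitz t (n - 1 - evenHalf n k) c
  have h := det_transpose_mul_eq_sum_strictMono A B
  have hp : ∀ J : Matrix (Fin α) (Fin α) ℤ,
      (J.submatrix id Fin.revPerm).det =
        ((Equiv.Perm.sign (Fin.revPerm : Equiv.Perm (Fin α)) : ℤˣ) : ℤ) * J.det := by
    intro J
    rw [Matrix.det_permute', Int.cast_id]
  rw [← hp]
  refine Eq.trans h.symm ?_
  congr 1
  ext c d
  have hc := c.isLt
  have hd := d.isLt
  obtain ⟨m, hm⟩ : ∃ m, n = m + 1 := ⟨n - 1, by omega⟩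
  simp only [Matrix.mul_apply, Matrix.transpose_apply, A, B, Matrix.of_apply,
    Matrix.submatrix_apply, id, Fin.revPerm_apply, Fin.val_rev]
  rw [sum_comp_evenHalf n (fun x => multichooseToeplitz s x c * multichooseToeplitz t (n - 1 - x) d),
    hm, Nat.add_sub_cancel, sum_multichooseToeplitz_mul]
  congr 1
  omega

/-! ### Reflected row pairs and the sign of sorting them by parity. -/

/-- The rows of a symmetric index set, listed as pairs of reflected rows. -/
noncomputable def reflectionEquiv (α : ℕ) : Bool × Fin α ≃ Fin (2 * α) :=
  Equiv.ofBijective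
    (fun x => ⟨if x.1 then α + x.2.val else α - 1 - x.2.val, by
      have := x.2.isLt
      split_ifs <;> omega⟩)
    ((Fintype.bijective_iff_injective_and_card _).mpr ⟨by
      rintro ⟨x, i⟩ ⟨y, j⟩ h
      have hi := i.isLt
      have hj := j.isLt
      have h' := congrArg Fin.val h
      cases x <;> cases y <;> simp at h' ⊢ <;> omega, by simp⟩)

/-- The columns, listed by parity. -/
noncomputable def parityEquiv (α : ℕ) : Bool × Fin α ≃ Fin (2 * α) :=
  Equiv.ofBijective
    (fun x => ⟨if x.1 then 2 * x.2.val + 1 else 2 * x.2.val, by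
      have := x.2.isLt
      split_ifs <;> omega⟩)
    ((Fintype.bijective_iff_injective_and_card _).mpr ⟨by
      rintro ⟨x, i⟩ ⟨y, j⟩ h
      have h' := congrArg Fin.val h
      cases x <;> cases y <;> simp at h' ⊢ <;> omega, by simp⟩)

/-- The sign of the rearrangement of reflected pairs by parity. -/
noncomputable def reflectionSign (α : ℕ) : ℤˣ :=
  Equiv.Perm.sign ((reflectionEquiv α).trans (parityEquiv α).symm)

/-- The row indices `n - 1 - q i` and `n + q i`, in the order of the rows. -/
def reflectedRow {α n : ℕ} (q : Fin α → Fin n) (r : Fin (2 * α)) : ℕ :=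
  if h : α ≤ r.val then n + (q ⟨r.val - α, by omega⟩).val
  else n - 1 - (q ⟨α - 1 - r.val, by omega⟩).val

theorem reflectedRow_true {α n : ℕ} (q : Fin α → Fin n) (i : Fin α) :
    reflectedRow q (reflectionEquiv α (true, i)) = n + (q i).val := by
  have h : (reflectionEquiv α (true, i)).val = α + i.val := by simp [reflectionEquiv]
  rw [reflectedRow, dif_pos (by omega)]
  congr 4
  omega

theorem reflectedRow_false {α n : ℕ} (q : Fin α → Fin n) (i : Fin α) :
    reflectedRow q (reflectionEquiv α (false, i)) = n - 1 - (q i).val := by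
  have h : (reflectionEquiv α (false, i)).val = α - 1 - i.val := by simp [reflectionEquiv]
  have := i.isLt
  rw [reflectedRow, dif_neg (by omega)]
  congr 4
  omega

/-- If the even member of a pair is `2e`, the odd one is `2(n - 1 - e) + 1`; these halves index the
two minors. The sorting permutation is a fixed rearrangement composed with one swap for every pair
whose upper member `n + q i` is even. -/
theorem det_reflectedRow {α n : ℕ} (N : ℕ) (q : Fin α → Fin n) :
    (Matrix.of fun r c : Fin (2 * α) => alternatingToeplitz N (reflectedRow q r) c).det =
      (reflectionSign α : ℤ) * (∏ i, (-1) ^ (n + (q i).val + 1)) *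
      ((Matrix.of fun i c : Fin α => multichooseToeplitz (N / 2) (evenHalf n (q i)) c).det *
       (Matrix.of fun i c : Fin α =>
        multichooseToeplitz (N - N / 2) (n - 1 - evenHalf n (q i)) c).det) := by
  set T : Matrix (Fin (2 * α)) (Fin (2 * α)) ℤ :=
    Matrix.of fun r c : Fin (2 * α) => alternatingToeplitz N (reflectedRow q r) c with hT
  let τ : Equiv.Perm (Bool × Fin α) := Equiv.prodCongrLeft fun i =>
    if (n + (q i).val) % 2 = 0 then Equiv.swap false true else 1
  have hτ : ((Equiv.Perm.sign τ : ℤˣ) : ℤ) = ∏ i, (-1) ^ (n + (q i).val + 1) := by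
    rw [Equiv.Perm.sign_prodCongrLeft, Units.coe_prod]
    refine Finset.prod_congr rfl fun i _ => ?_
    split_ifs with h
    · rw [Equiv.Perm.sign_swap (by simp), Odd.neg_one_pow (by rw [Nat.odd_iff]; omega)]
      simp
    · rw [Equiv.Perm.sign_one, Even.neg_one_pow (by rw [Nat.even_iff]; omega)]
      simp
  let ρ : Equiv.Perm (Bool × Fin α) := (reflectionEquiv α).trans (parityEquiv α).symm * τ
  have hρ : ((Equiv.Perm.sign ρ : ℤˣ) : ℤ) =
      (reflectionSign α : ℤ) * ∏ i, (-1) ^ (n + (q i).val + 1) := by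
    rw [← hτ, Equiv.Perm.sign_mul, Units.val_mul]
    rfl
  have h1 : (T.submatrix (parityEquiv α) (parityEquiv α)).det = T.det :=
    Matrix.det_submatrix_equiv_self _ _
  have h2 := Matrix.det_permute ρ (T.submatrix (parityEquiv α) (parityEquiv α))
  rw [h1, Int.cast_id] at h2
  have h3 : ((Equiv.Perm.sign ρ : ℤˣ) : ℤ) * ((Equiv.Perm.sign ρ : ℤˣ) : ℤ) = 1 := by
    rw [← Units.val_mul, Int.units_mul_self, Units.val_one]
  have h4 : T.det = ((Equiv.Perm.sign ρ : ℤˣ) : ℤ) *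
      ((T.submatrix (parityEquiv α) (parityEquiv α)).submatrix ρ id).det := by
    rw [h2, ← mul_assoc, h3, one_mul]
  rw [h4, hρ, ← det_alternatingToeplitz_blocks]
  congr 1
  rw [← Matrix.det_submatrix_equiv_self (Equiv.boolProdEquivSum (Fin α)).symm]
  congr 1
  have hcf : ∀ c : Fin α, (parityEquiv α (false, c)).val = 2 * c.val := by
    intro c; simp [parityEquiv]
  have hct : ∀ c : Fin α, (parityEquiv α (true, c)).val = 2 * c.val + 1 := by
    intro c; simp [parityEquiv]
  have hrow : ∀ (x : Bool) (i : Fin α), reflectedRow q (parityEquiv α (ρ (x, i))) =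
      if x then 2 * (n - 1 - evenHalf n (q i)) + 1 else 2 * evenHalf n (q i) := by
    intro x i
    have hq := (q i).isLt
    have : parityEquiv α (ρ (x, i)) = reflectionEquiv α (τ (x, i)) := by simp [ρ]
    rw [this]
    simp only [τ, Equiv.prodCongrLeft_apply, evenHalf]
    by_cases h : (n + (q i).val) % 2 = 0
    · cases x
      · simp only [if_pos h, Equiv.swap_apply_left, reflectedRow_true]
        simp only [Bool.false_eq_true, if_false]
        omega
      · simp only [if_pos h, Equiv.swap_apply_right, reflectedRow_false, if_true]
        omega
    · cases x
      · simp only [if_neg h, Equiv.Perm.coe_one, id, reflectedRow_false]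
        simp only [Bool.false_eq_true, if_false]
        omega
      · simp only [if_neg h, Equiv.Perm.coe_one, id, reflectedRow_true, if_true]
        omega
  ext x y
  rcases x with i | i <;> rcases y with c | c <;>
    simp [T, hrow, hcf, hct, Equiv.boolProdEquivSum]

/-! ### The sum over self-complementary shapes. -/

/-- `ν` lists the row lengths, in increasing order, of a partition that is self-complementary in
the `a × b` rectangle. -/
def IsSelfComplementaryShape {a b : ℕ} (ν : Fin a → Fin (b + 1)) : Prop :=
  Monotone ν ∧ ∀ i j : Fin a, i.val + j.val + 1 = a → (ν i).val + (ν j).val = b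

/-- Self-complementarity makes the set of row indices `ν r + r` symmetric under `x ↦ 2(α + β) - 1 -
x`. -/
theorem signedChainSum_eq_det_reflectedRow {α β : ℕ} (N : ℕ)
    (ν : Fin (2 * α) → Fin (2 * β + 1)) (hν : IsSelfComplementaryShape ν)
    (q : Fin α → Fin (α + β))
    (hq : ∀ i : Fin α, (ν ⟨α + i.val, by omega⟩).val + i.val = β + (q i).val) :
    signedChainSum (2 * α) (2 * β) N ν =
      (Matrix.of fun r c : Fin (2 * α) => alternatingToeplitz N (reflectedRow q r) c).det := by
  rw [signedChainSum_eq_det N ν hν.1]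
  congr 1
  ext r c
  rw [Matrix.of_apply]
  congr 1
  have hr := r.isLt
  by_cases h : α ≤ r.val
  · rw [reflectedRow, dif_pos h]
    have := hq ⟨r.val - α, by omega⟩
    have e : (⟨α + (r.val - α), by omega⟩ : Fin (2 * α)) = r := Fin.ext (by simp only; omega)
    simp only [e] at this
    omega
  · rw [reflectedRow, dif_neg h]
    have := hq ⟨α - 1 - r.val, by omega⟩
    have h' := hν.2 r ⟨α + (α - 1 - r.val), by omega⟩ (by simp only; omega)
    have hlt := (q ⟨α - 1 - r.val, by omega⟩).isLt
    simp only at this h'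
    omega

open Classical in
theorem sum_selfComplementaryShape (α β N : ℕ) :
    ∑ ν : Fin (2 * α) → Fin (2 * β + 1) with IsSelfComplementaryShape ν,
      (-1) ^ (∑ i : Fin α, (ν ⟨α + i.val, by omega⟩).val) *
        signedChainSum (2 * α) (2 * β) N ν =
    ((reflectionSign α : ℤ) * (∏ i : Fin α, (-1) ^ (α + 1 + i.val)) *
      ((Equiv.Perm.sign (Fin.revPerm : Equiv.Perm (Fin α)) : ℤˣ) : ℤ)) *
      (Matrix.of fun i j : Fin α => intMultichoose N (β - i + j)).det := by
  have hN : N / 2 + (N - N / 2) = N := by omega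
  have hCB := sum_strictMono_det_mul_det α β (N / 2) (N - N / 2)
  rw [hN] at hCB
  rw [mul_assoc, ← hCB, Finset.mul_sum]
  -- Two reflected entries sum to `2β` and the upper one is the larger.
  have hmid : ∀ ν : Fin (2 * α) → Fin (2 * β + 1), IsSelfComplementaryShape ν → ∀ i : Fin α,
      β ≤ (ν ⟨α + i.val, by omega⟩).val := by
    intro ν hν i
    have h1 := hν.2 ⟨α + i.val, by omega⟩ ⟨α - 1 - i.val, by omega⟩ (by simp only; omega)
    have h2 : ν ⟨α - 1 - i.val, by omega⟩ ≤ ν ⟨α + i.val, by omega⟩ :=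
      hν.1 (by rw [Fin.le_def]; simp only; omega)
    rw [Fin.le_def] at h2
    omega
  refine Finset.sum_bij (fun ν hν i => ⟨(ν ⟨α + i.val, by omega⟩).val - β + i.val, by
      have := (ν ⟨α + i.val, by omega⟩).isLt
      omega⟩) ?_ ?_ ?_ ?_
  · intro ν hν
    simp only [Finset.mem_filter, Finset.mem_univ, true_and] at hν ⊢
    intro i j hij
    have h1 := hmid ν hν i
    have h2 : ν ⟨α + i.val, by omega⟩ ≤ ν ⟨α + j.val, by omega⟩ :=
      hν.1 (by rw [Fin.le_def] at *; simp only; omega)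
    rw [Fin.le_def] at h2
    rw [Fin.lt_def] at hij ⊢
    simp only
    omega
  · intro ν hν ν' hν' e
    simp only [Finset.mem_filter, Finset.mem_univ, true_and] at hν hν'
    have top : ∀ i : Fin α, (ν ⟨α + i.val, by omega⟩).val = (ν' ⟨α + i.val, by omega⟩).val := by
      intro i
      have := congrArg Fin.val (congrFun e i)
      have h1 := hmid ν hν i
      have h2 := hmid ν' hν' i
      simp only at this
      omega
    ext r
    have hr := r.isLt
    by_cases h : α ≤ r.val
    · have := top ⟨r.val - α, by omega⟩
      have e : (⟨α + (r.val - α), by omega⟩ : Fin (2 * α)) = r := Fin.ext (by simp only; omega)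
      simpa only [e] using this
    · have h0 := top ⟨α - 1 - r.val, by omega⟩
      have h1 := hν.2 r ⟨α + (α - 1 - r.val), by omega⟩ (by simp only; omega)
      have h2 := hν'.2 r ⟨α + (α - 1 - r.val), by omega⟩ (by simp only; omega)
      simp only at h0
      omega
  · intro q hq
    simp only [Finset.mem_filter, Finset.mem_univ, true_and] at hq
    -- `q i - i` is weakly increasing; with `q < α + β` this keeps it between `0` and `β`, so that
    -- it is the excess of the upper half of a shape over `β`.
    have hstep : ∀ i j : Fin α, i.val ≤ j.val → (q i).val + j.val ≤ (q j).val + i.val := by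
      intro i j hij
      obtain ⟨d, hd⟩ := Nat.exists_eq_add_of_le hij
      induction d generalizing j with
      | zero =>
        have : i = j := Fin.ext (by omega)
        subst this
        exact le_rfl
      | succ d ih =>
        have hj := j.isLt
        have h1 := ih ⟨i.val + d, by omega⟩ (by simp) rfl
        have h2 : q ⟨i.val + d, by omega⟩ < q j := hq (by rw [Fin.lt_def]; simp only; omega)
        rw [Fin.lt_def] at h2
        simp only at h1
        omega
    have hlo : ∀ i : Fin α, i.val ≤ (q i).val := by
      intro i
      have := hstep ⟨0, i.pos⟩ i (by simp)
      simp only at this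
      omega
    have hhi : ∀ i : Fin α, (q i).val ≤ β + i.val := by
      intro i
      have := hstep i ⟨α - 1, by have := i.isLt; omega⟩ (by have := i.isLt; simp only; omega)
      have h2 := (q ⟨α - 1, by have := i.isLt; omega⟩).isLt
      have := i.isLt
      simp only at *
      omega
    let ν : Fin (2 * α) → Fin (2 * β + 1) := fun r =>
      if h : α ≤ r.val then ⟨(q ⟨r.val - α, by omega⟩).val + β - (r.val - α), by
          have := hhi ⟨r.val - α, by omega⟩
          simp only at this
          omega⟩
      else ⟨β + (α - 1 - r.val) - (q ⟨α - 1 - r.val, by omega⟩).val, by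
          have := hlo ⟨α - 1 - r.val, by omega⟩
          simp only at this
          omega⟩
    refine ⟨ν, ?_, ?_⟩
    · simp only [Finset.mem_filter, Finset.mem_univ, true_and]
      constructor
      · intro r r' hr
        rw [Fin.le_def] at hr ⊢
        have hr1 := r.isLt
        have hr2 := r'.isLt
        by_cases h : α ≤ r.val
        · have h' : α ≤ r'.val := by omega
          have := hstep ⟨r.val - α, by omega⟩ ⟨r'.val - α, by omega⟩ (by simp only; omega)
          have h1 := hlo ⟨r.val - α, by omega⟩
          simp only [ν, dif_pos h, dif_pos h'] at *
          omega
        · by_cases h' : α ≤ r'.val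
          · have h1 := hlo ⟨r'.val - α, by omega⟩
            have h2 := hlo ⟨α - 1 - r.val, by omega⟩
            simp only [ν, dif_neg h, dif_pos h'] at *
            omega
          · have := hstep ⟨α - 1 - r'.val, by omega⟩ ⟨α - 1 - r.val, by omega⟩
              (by simp only; omega)
            have h1 := hhi ⟨α - 1 - r.val, by omega⟩
            have h2 := hhi ⟨α - 1 - r'.val, by omega⟩
            simp only [ν, dif_neg h, dif_neg h'] at *
            omega
      · have main : ∀ i j : Fin (2 * α), i.val + j.val + 1 = 2 * α → α ≤ j.val →
            (ν i).val + (ν j).val = 2 * β := by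
          intro i j hij h
          have h' : ¬ α ≤ i.val := by omega
          have e : (⟨α - 1 - i.val, by omega⟩ : Fin α) = ⟨j.val - α, by omega⟩ :=
            Fin.ext (by simp only; omega)
          have h1 := hhi ⟨j.val - α, by omega⟩
          have h2 := hlo ⟨j.val - α, by omega⟩
          simp only [ν, dif_neg h', dif_pos h, e] at *
          omega
        intro i j hij
        by_cases h : α ≤ j.val
        · exact main i j hij h
        · rw [add_comm]
          exact main j i (by omega) (by omega)
    · ext i
      have h1 := hlo i
      have e : (⟨α + i.val - α, by omega⟩ : Fin α) = i := Fin.ext (by simp only; omega)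
      simp only [ν, dif_pos (show α ≤ α + i.val by omega), e]
      omega
  · intro ν hν
    simp only [Finset.mem_filter, Finset.mem_univ, true_and] at hν
    have hm := hmid ν hν
    let q : Fin α → Fin (α + β) := fun i => ⟨(ν ⟨α + i.val, by omega⟩).val - β + i.val, by
      have := (ν ⟨α + i.val, by omega⟩).isLt
      omega⟩
    have hq : ∀ i : Fin α, (ν ⟨α + i.val, by omega⟩).val + i.val = β + (q i).val := by
      intro i
      have := hm i
      simp only [q]
      omega
    -- Since `ν (α + i) + i = β + q i`, the two signs multiply to one that does not depend on `ν`.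
    have hsign : (-1 : ℤ) ^ (∑ i : Fin α, (ν ⟨α + i.val, by omega⟩).val) *
        ∏ i, (-1) ^ (α + β + (q i).val + 1) = ∏ i : Fin α, (-1) ^ (α + 1 + i.val) := by
      rw [← Finset.prod_pow_eq_pow_sum, ← Finset.prod_mul_distrib]
      refine Finset.prod_congr rfl fun i _ => ?_
      have := hm i
      have h' := hq i
      rw [← pow_add]
      obtain ⟨x, hx⟩ := Nat.exists_eq_add_of_le this
      have e : (ν ⟨α + i.val, by omega⟩).val + (α + β + (q i).val + 1) =
          2 * (β + x) + (α + 1 + i.val) := by omega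
      rw [e, pow_add, pow_mul]
      simp
    rw [signedChainSum_eq_det_reflectedRow N ν hν q hq, det_reflectedRow, ← hsign]
    ring

open Classical in
/-- The signed sum over all chains from the empty partition to a self-complementary partition. -/
theorem sum_selfComplementaryShape_eq_macMahonBox (α β γ : ℕ) :
    ((∑ ν : Fin (2 * α) → Fin (2 * β + 1) with IsSelfComplementaryShape ν,
      (-1) ^ (∑ i : Fin α, (ν ⟨α + i.val, by omega⟩).val) *
        signedChainSum (2 * α) (2 * β) (α + γ) ν : ℤ) : ℚ) = macMahonBox α β γ := by
  -- The constant sign depends on `α` alone, so it can be read off from the case `β = N = 0`, where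
  -- the only shape is zero and the Jacobi–Trudi matrix is the identity.
  have hone : ((reflectionSign α : ℤ) * (∏ i : Fin α, (-1) ^ (α + 1 + i.val)) *
      ((Equiv.Perm.sign (Fin.revPerm : Equiv.Perm (Fin α)) : ℤˣ) : ℤ)) = 1 := by
    have h := sum_selfComplementaryShape α 0 0
    have hJ : (Matrix.of fun i j : Fin α => intMultichoose 0 (((0 : ℕ) : ℤ) - i + j)) = 1 := by
      ext i j
      rw [Matrix.of_apply, Matrix.one_apply, intMultichoose]
      rcases lt_trichotomy i.val j.val with hij | hij | hij
      · have e : (((0 : ℕ) : ℤ) - i + j).toNat = (j.val - i.val - 1) + 1 := by omega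
        rw [if_pos (by omega), e, Nat.multichoose_zero_succ, if_neg (by rw [Fin.ext_iff]; omega)]
        rfl
      · have e : (((0 : ℕ) : ℤ) - i + j).toNat = 0 := by omega
        rw [if_pos (by omega), e, if_pos (Fin.ext hij)]
        simp
      · rw [if_neg (by omega), if_neg (by rw [Fin.ext_iff]; omega)]
    rw [hJ, Matrix.det_one, mul_one] at h
    have : Subsingleton (Fin (2 * 0 + 1)) := inferInstanceAs (Subsingleton (Fin 1))
    have h0 : IsSelfComplementaryShape (0 : Fin (2 * α) → Fin (2 * 0 + 1)) :=
      ⟨fun _ _ _ => le_rfl, fun i j _ => by simp⟩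
    rw [← h, Finset.sum_filter,
      Fintype.sum_eq_single 0 fun ν hν => (hν (Subsingleton.elim _ _)).elim, if_pos h0]
    simp [signedChainSum]
  rw [sum_selfComplementaryShape, hone, one_mul]
  exact det_multichoose_eq_macMahonBox α β γ

/-! ### Diagonal slices of plane partitions. -/

/-- The diagonal slices of a set of cubes: the number of cubes over position `r` of the `t`-th
diagonal of the `a × c` side of the box, where positions below the box count as full. -/
def diagonalSlice (a b c : ℕ) (P : Finset (ℕ × ℕ × ℕ)) (t r : ℕ) : ℕ :=
  ((Finset.Icc 1 b).filter fun j => a + c - r - t = 0 ∨ (a - r, j, a + c - r - t) ∈ P).card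

theorem le_card_filter_Icc_iff {b : ℕ} {p : ℕ → Prop} [DecidablePred p]
    (hp : ∀ j j', 1 ≤ j' → j' ≤ j → p j → p j') {j : ℕ} (h1 : 1 ≤ j) (hb : j ≤ b) :
    j ≤ ((Finset.Icc 1 b).filter p).card ↔ p j := by
  constructor
  · intro h
    by_contra hj
    have : (Finset.Icc 1 b).filter p ⊆ Finset.Icc 1 (j - 1) := by
      intro x hx
      rw [Finset.mem_filter, Finset.mem_Icc] at hx
      rw [Finset.mem_Icc]
      refine ⟨hx.1.1, ?_⟩
      by_contra hlt
      exact hj (hp x j h1 (by omega) hx.2)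
    have := Finset.card_le_card this
    rw [Nat.card_Icc] at this
    omega
  · intro h
    have : Finset.Icc 1 j ⊆ (Finset.Icc 1 b).filter p := by
      intro x hx
      rw [Finset.mem_Icc] at hx
      rw [Finset.mem_filter, Finset.mem_Icc]
      exact ⟨⟨hx.1, by omega⟩, hp j x hx.1 hx.2 h⟩
    have := Finset.card_le_card this
    rw [Nat.card_Icc] at this
    omega

theorem diagonalSlice_le (a b c : ℕ) (P : Finset (ℕ × ℕ × ℕ)) (t r : ℕ) :
    diagonalSlice a b c P t r ≤ b := by
  refine (Finset.card_filter_le _ _).trans ?_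
  simp

section
variable {a b c : ℕ} {P : Finset (ℕ × ℕ × ℕ)}

theorem mem_selfCompPlanePartitions :
    P ∈ selfCompPlanePartitions a b c ↔
      P ⊆ cubeBox a b c ∧ IsPlanePartition P ∧ IsSelfComplementary a b c P := by
  simp [selfCompPlanePartitions]

theorem mem_cubeBox {i j k : ℕ} :
    (i, j, k) ∈ cubeBox a b c ↔ (1 ≤ i ∧ i ≤ a) ∧ (1 ≤ j ∧ j ≤ b) ∧ 1 ≤ k ∧ k ≤ c := by
  simp [cubeBox]

theorem diagonalSlice_eq_of_le {t r : ℕ} (h : a + c ≤ t + r) :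
    diagonalSlice a b c P t r = b := by
  have : a + c - r - t = 0 := by omega
  simp [diagonalSlice, this]

theorem diagonalSlice_eq_zero (hP : P ⊆ cubeBox a b c) {t r : ℕ} (h : t + r < a) :
    diagonalSlice a b c P t r = 0 := by
  rw [diagonalSlice, Finset.card_eq_zero, Finset.filter_eq_empty_iff]
  rintro j _ (h0 | h0)
  · omega
  · have := mem_cubeBox.mp (hP h0)
    omega

/-- Row `r` of diagonal `t` is the column over `i = a - r`, `k = a + c - r - t`. Raising `t` lowers
`k` by one and fixes `i`. -/
theorem diagonalSlice_mono_left (hP : IsPlanePartition P) {t r : ℕ} :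
    diagonalSlice a b c P t r ≤ diagonalSlice a b c P (t + 1) r := by
  refine Finset.card_le_card fun j hj => ?_
  rw [Finset.mem_filter] at hj ⊢
  refine ⟨hj.1, ?_⟩
  rcases hj.2 with h | h
  · left; omega
  · by_cases h0 : a + c - r - (t + 1) = 0
    · exact Or.inl h0
    · right
      have h1 := hP.1 _ _ _ h
      exact hP.2 _ _ _ _ _ _ h h1.1 le_rfl h1.2.1 le_rfl (by omega) (by omega)

/-- Passing from `(t + 1, r)` to `(t, r + 1)` lowers `i` by one and fixes `k`. -/
theorem diagonalSlice_succ_le (hP : IsPlanePartition P) {t r : ℕ} (hr : r + 1 < a) :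
    diagonalSlice a b c P (t + 1) r ≤ diagonalSlice a b c P t (r + 1) := by
  refine Finset.card_le_card fun j hj => ?_
  rw [Finset.mem_filter] at hj ⊢
  refine ⟨hj.1, ?_⟩
  have e : a + c - r - (t + 1) = a + c - (r + 1) - t := by omega
  rw [e] at hj
  rcases hj.2 with h | h
  · exact Or.inl h
  · right
    have h1 := hP.1 _ _ _ h
    exact hP.2 _ _ _ _ _ _ h (by omega) (by omega) h1.2.1 le_rfl h1.2.2 le_rfl

theorem diagonalSlice_add_reflection (hP : P ∈ selfCompPlanePartitions a b c) {t r t' r' : ℕ}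
    (hr : r + r' + 1 = a) (ht : t + t' = a + c) :
    diagonalSlice a b c P t r + diagonalSlice a b c P t' r' = b := by
  obtain ⟨hbox, -, hsc⟩ := mem_selfCompPlanePartitions.mp hP
  by_cases h1 : a + c ≤ t + r
  · rw [diagonalSlice_eq_of_le h1, diagonalSlice_eq_zero hbox (by omega), add_zero]
  by_cases h2 : a + c ≤ t' + r'
  · rw [diagonalSlice_eq_of_le h2, diagonalSlice_eq_zero hbox (by omega), zero_add]
  -- Inside the box, `j ↦ b + 1 - j` identifies the reflected column with the complement of the
  -- original one.
  have hcard : diagonalSlice a b c P t' r' = ((Finset.Icc 1 b).filter fun j =>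
      ¬ (a + c - r - t = 0 ∨ (a - r, j, a + c - r - t) ∈ P)).card := by
    have refl : ∀ j, j ∈ Finset.Icc 1 b → ((a - r, j, a + c - r - t) ∈ P ↔
        (a - r', b + 1 - j, a + c - r' - t') ∉ P) := by
      intro j hj
      rw [Finset.mem_Icc] at hj
      have := hsc (a - r) j (a + c - r - t) (mem_cubeBox.mpr (by omega))
      rwa [show a + 1 - (a - r) = a - r' by omega,
        show c + 1 - (a + c - r - t) = a + c - r' - t' by omega] at this
    have hz : ¬ a + c - r - t = 0 := by omega
    have hz' : ¬ a + c - r' - t' = 0 := by omega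
    refine Finset.card_nbij' (fun j => b + 1 - j) (fun j => b + 1 - j) ?_ ?_ ?_ ?_
    · intro j hj
      simp only [Finset.coe_filter, Set.mem_ofPred_eq, Finset.mem_Icc, hz, hz', false_or] at hj ⊢
      refine ⟨by omega, ?_⟩
      rw [refl _ (by rw [Finset.mem_Icc]; omega), not_not,
        show b + 1 - (b + 1 - j) = j by omega]
      exact hj.2
    · intro j hj
      simp only [Finset.coe_filter, Set.mem_ofPred_eq, Finset.mem_Icc, hz, hz', false_or] at hj ⊢
      refine ⟨by omega, ?_⟩
      have := hj.2
      rwa [refl _ (by rw [Finset.mem_Icc]; omega), not_not] at this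
    · intro j hj
      simp only [Finset.coe_filter, Set.mem_ofPred_eq, Finset.mem_Icc] at hj ⊢
      omega
    · intro j hj
      simp only [Finset.coe_filter, Set.mem_ofPred_eq, Finset.mem_Icc] at hj ⊢
      omega
  rw [hcard, diagonalSlice, Finset.card_filter_add_card_filter_not]
  simp

theorem mem_iff_le_diagonalSlice (hP : IsPlanePartition P) {i j k : ℕ}
    (h : (i, j, k) ∈ cubeBox a b c) :
    (i, j, k) ∈ P ↔ j ≤ diagonalSlice a b c P (c + i - k) (a - i) := by
  rw [mem_cubeBox] at h
  rw [diagonalSlice, le_card_filter_Icc_iff _ h.2.1.1 h.2.1.2]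
  · rw [show a + c - (a - i) - (c + i - k) = k by omega, show a - (a - i) = i by omega]
    have : k ≠ 0 := by omega
    simp [this]
  · rintro j j' h1 h2 (h3 | h3)
    · exact Or.inl h3
    · have h4 := hP.1 _ _ _ h3
      exact Or.inr (hP.2 _ _ _ _ _ _ h3 h4.1 le_rfl h1 h2 h4.2.2 le_rfl)

end

/-! ### Recovering the plane partition from its slices, and from half of them. -/

/-- The relations between the diagonal slices of a self-complementary plane partition. -/
structure IsDiagonalSystem (a b c : ℕ) (E : ℕ → ℕ → ℕ) : Prop where
  zero : ∀ r, r < a → E 0 r = 0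
  mono : ∀ t r, t < a + c → r < a → E t r ≤ E (t + 1) r
  interlace : ∀ t r, t < a + c → r + 1 < a → E (t + 1) r ≤ E t (r + 1)
  reflect : ∀ t t' r r', t + t' = a + c → r + r' + 1 = a → E t r + E t' r' = b

/-- The set of cubes with prescribed diagonal slices. -/
def cubesOfDiagonals (a b c : ℕ) (E : ℕ → ℕ → ℕ) : Finset (ℕ × ℕ × ℕ) :=
  (cubeBox a b c).filter fun p => p.2.1 ≤ E (c + p.1 - p.2.2) (a - p.1)

namespace IsDiagonalSystem
variable {a b c : ℕ} {E : ℕ → ℕ → ℕ}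

theorem mono_add (h : IsDiagonalSystem a b c E) {t r : ℕ} (d : ℕ) (ht : t + d ≤ a + c)
    (hr : r < a) : E t r ≤ E (t + d) r := by
  induction d with
  | zero => exact le_rfl
  | succ d ih => exact (ih (by omega)).trans (h.mono (t + d) r (by omega) hr)

theorem interlace_add (h : IsDiagonalSystem a b c E) {t r : ℕ} (d : ℕ) (ht : t + d ≤ a + c)
    (hr : r + d < a) : E (t + d) r ≤ E t (r + d) := by
  induction d generalizing r with
  | zero => exact le_rfl
  | succ d ih =>
    refine (h.interlace (t + d) r (by omega) (by omega)).trans ?_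
    have := ih (r := r + 1) (by omega) (by omega)
    rwa [show r + 1 + d = r + (d + 1) by ring] at this

theorem eq_zero (h : IsDiagonalSystem a b c E) {t r : ℕ} (htr : t + r < a) : E t r = 0 := by
  have h1 := h.interlace_add (t := 0) (r := r) t (by omega) (by omega)
  have h2 := h.zero (r + t) (by omega)
  rw [zero_add] at h1
  omega

theorem eq_top (h : IsDiagonalSystem a b c E) {t r : ℕ} (ht : t ≤ a + c) (hr : r < a)
    (htr : a + c ≤ t + r) : E t r = b := by
  have h1 := h.reflect t (a + c - t) r (a - 1 - r) (by omega) (by omega)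
  have h2 := h.eq_zero (t := a + c - t) (r := a - 1 - r) (by omega)
  omega

theorem le (h : IsDiagonalSystem a b c E) {t r : ℕ} (ht : t ≤ a + c) (hr : r < a) :
    E t r ≤ b := by
  have h1 := h.reflect t (a + c - t) r (a - 1 - r) (by omega) (by omega)
  omega

theorem cubesOfDiagonals_mem (h : IsDiagonalSystem a b c E) :
    cubesOfDiagonals a b c E ∈ selfCompPlanePartitions a b c := by
  rw [mem_selfCompPlanePartitions]
  refine ⟨Finset.filter_subset _ _, ⟨?_, ?_⟩, ?_⟩
  · intro i j k hm
    have := mem_cubeBox.mp (Finset.mem_of_mem_filter _ hm)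
    omega
  · intro i j k i' j' k' hm hi hi' hj hj' hk hk'
    rw [cubesOfDiagonals, Finset.mem_filter, mem_cubeBox] at hm ⊢
    refine ⟨by omega, ?_⟩
    simp only at hm ⊢
    -- Lowering `i` is a series of interlacing steps, and lowering `k` is monotonicity in `t`.
    have h1 := h.interlace_add (t := c + i' - k) (r := a - i) (i - i') (by omega) (by omega)
    have h2 := h.mono_add (t := c + i' - k) (r := a - i') (k - k') (by omega) (by omega)
    rw [show c + i' - k + (i - i') = c + i - k by omega,
      show a - i + (i - i') = a - i' by omega] at h1
    rw [show c + i' - k + (k - k') = c + i' - k' by omega] at h2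
    omega
  · intro i j k hm
    rw [cubesOfDiagonals, Finset.mem_filter, Finset.mem_filter]
    have hm' := mem_cubeBox.mp hm
    have hm2 : (a + 1 - i, b + 1 - j, c + 1 - k) ∈ cubeBox a b c := mem_cubeBox.mpr (by omega)
    have h1 := h.reflect (c + i - k) (c + (a + 1 - i) - (c + 1 - k)) (a - i) (a - (a + 1 - i))
      (by omega) (by omega)
    simp only [hm, hm2, true_and]
    omega

theorem diagonalSlice_cubesOfDiagonals (h : IsDiagonalSystem a b c E) {t r : ℕ}
    (ht : t ≤ a + c) (hr : r < a) :
    diagonalSlice a b c (cubesOfDiagonals a b c E) t r = E t r := by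
  by_cases h1 : a + c ≤ t + r
  · rw [diagonalSlice_eq_of_le h1, h.eq_top ht hr h1]
  by_cases h2 : t + r < a
  · have hsub : cubesOfDiagonals a b c E ⊆ cubeBox a b c := Finset.filter_subset _ _
    rw [diagonalSlice_eq_zero hsub h2, h.eq_zero h2]
  have : (Finset.Icc 1 b).filter (fun j => a + c - r - t = 0 ∨
      (a - r, j, a + c - r - t) ∈ cubesOfDiagonals a b c E) = Finset.Icc 1 (E t r) := by
    ext j
    have hle := h.le ht hr
    rw [Finset.mem_filter, cubesOfDiagonals, Finset.mem_filter, mem_cubeBox, Finset.mem_Icc,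
      Finset.mem_Icc]
    simp only
    rw [show c + (a - r) - (a + c - r - t) = t by omega, show a - (a - r) = r by omega]
    omega
  rw [diagonalSlice, this]
  simp

end IsDiagonalSystem

theorem isDiagonalSystem_diagonalSlice {a b c : ℕ} {P : Finset (ℕ × ℕ × ℕ)}
    (hP : P ∈ selfCompPlanePartitions a b c) :
    IsDiagonalSystem a b c (diagonalSlice a b c P) := by
  obtain ⟨hbox, hpp, -⟩ := mem_selfCompPlanePartitions.mp hP
  exact ⟨fun r hr => diagonalSlice_eq_zero hbox (by omega),
    fun t r _ _ => diagonalSlice_mono_left hpp,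
    fun t r _ hr => diagonalSlice_succ_le hpp hr,
    fun t t' r r' ht hr => diagonalSlice_add_reflection hP hr ht⟩

/-- Chains of interlacing partitions from the empty partition to a self-complementary one. -/
def IsSelfComplementaryChain {a b N : ℕ} (S : Fin (N + 1) → Fin a → Fin (b + 1)) : Prop :=
  S 0 = 0 ∧ (∀ s : Fin N, Interlaces (S s.castSucc) (S s.succ)) ∧
    IsSelfComplementaryShape (S (Fin.last N))

/-- The values of a chain, and their continuation by reflection. -/
def chainExtension {a b N : ℕ} (c : ℕ) (S : Fin (N + 1) → Fin a → Fin (b + 1)) (t r : ℕ) : ℕ :=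
  if h : r < a then
    if ht : t < N + 1 then (S ⟨t, ht⟩ ⟨r, h⟩).val
    else if ht' : a + c - t < N + 1 then b - (S ⟨a + c - t, ht'⟩ ⟨a - 1 - r, by omega⟩).val
    else 0
  else 0

theorem chainExtension_of_le {a b c N : ℕ} (S : Fin (N + 1) → Fin a → Fin (b + 1)) {t r : ℕ}
    (ht : t < N + 1) (hr : r < a) : chainExtension c S t r = (S ⟨t, ht⟩ ⟨r, hr⟩).val := by
  rw [chainExtension, dif_pos hr, dif_pos ht]

theorem chainExtension_of_gt {a b c N : ℕ} (S : Fin (N + 1) → Fin a → Fin (b + 1)) {t r : ℕ}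
    (ht : ¬ t < N + 1) (ht' : a + c - t < N + 1) (hr : r < a) :
    chainExtension c S t r = b - (S ⟨a + c - t, ht'⟩ ⟨a - 1 - r, by omega⟩).val := by
  rw [chainExtension, dif_pos hr, dif_neg ht, dif_pos ht']

/-- The inequalities beyond the middle are the reflections of those before it. At the middle itself
the reflection relation is the self-complementarity of the last partition. -/
theorem isDiagonalSystem_chainExtension {a b c N : ℕ} (hN : a + c = 2 * N)
    {S : Fin (N + 1) → Fin a → Fin (b + 1)} (hS : IsSelfComplementaryChain S) :
    IsDiagonalSystem a b c (chainExtension c S) := by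
  obtain ⟨h0, hstep, hmono, hsc⟩ := hS
  have hlow : ∀ t r, t < N + 1 → r < a → chainExtension c S t r ≤ b := by
    intro t r ht hr
    rw [chainExtension_of_le S ht hr]
    omega
  have hrefl : ∀ t t' r r', t ≤ N → t + t' = a + c → r + r' + 1 = a →
      chainExtension c S t r + chainExtension c S t' r' = b := by
    intro t t' r r' ht htt hrr
    rcases Nat.lt_or_ge t N with h | h
    · rw [chainExtension_of_gt S (t := t') (by omega) (by omega) (by omega),
        chainExtension_of_le S (t := t) (by omega) (by omega)]
      have e1 : (⟨a + c - t', by omega⟩ : Fin (N + 1)) = ⟨t, by omega⟩ :=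
        Fin.ext (by simp only; omega)
      have e2 : (⟨a - 1 - r', by omega⟩ : Fin a) = ⟨r, by omega⟩ := Fin.ext (by simp only; omega)
      rw [e1, e2]
      omega
    · obtain rfl : t = N := by omega
      obtain rfl : t' = t := by omega
      rw [chainExtension_of_le S (by omega) (by omega),
        chainExtension_of_le S (by omega) (by omega)]
      exact hsc _ _ (by simp only; omega)
  have hrefl' : ∀ t t' r r', t + t' = a + c → r + r' + 1 = a →
      chainExtension c S t r + chainExtension c S t' r' = b := by
    intro t t' r r' htt hrr
    rcases Nat.lt_or_ge N t with h | h
    · rw [add_comm]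
      exact hrefl t' t r' r (by omega) (by omega) (by omega)
    · exact hrefl t t' r r' h htt hrr
  have hm : ∀ t r, t < N → r < a → chainExtension c S t r ≤ chainExtension c S (t + 1) r := by
    intro t r ht hr
    rw [chainExtension_of_le S (by omega) hr, chainExtension_of_le S (by omega) hr]
    exact (hstep ⟨t, ht⟩).1 ⟨r, hr⟩
  have hi : ∀ t r, t < N → r + 1 < a →
      chainExtension c S (t + 1) r ≤ chainExtension c S t (r + 1) := by
    intro t r ht hr
    rw [chainExtension_of_le S (by omega) (by omega), chainExtension_of_le S (by omega) hr]
    exact (hstep ⟨t, ht⟩).2 ⟨r, by omega⟩ ⟨r + 1, hr⟩ rfl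
  refine ⟨?_, ?_, ?_, hrefl'⟩
  · intro r hr
    rw [chainExtension_of_le S (by omega) hr]
    have : (⟨0, by omega⟩ : Fin (N + 1)) = 0 := rfl
    rw [this, h0]
    rfl
  · intro t r ht hr
    by_cases h : t < N
    · exact hm t r h hr
    · have h1 := hrefl' t (2 * N - t) r (a - 1 - r) (by omega) (by omega)
      have h2 := hrefl' (t + 1) (2 * N - (t + 1)) r (a - 1 - r) (by omega) (by omega)
      have h3 := hm (2 * N - (t + 1)) (a - 1 - r) (by omega) (by omega)
      rw [show 2 * N - (t + 1) + 1 = 2 * N - t by omega] at h3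
      omega
  · intro t r ht hr
    by_cases h : t < N
    · exact hi t r h hr
    · have h1 := hrefl' t (2 * N - t) (r + 1) (a - 1 - (r + 1)) (by omega) (by omega)
      have h2 := hrefl' (t + 1) (2 * N - (t + 1)) r (a - 1 - r) (by omega) (by omega)
      have h3 := hi (2 * N - (t + 1)) (a - 1 - (r + 1)) (by omega) (by omega)
      rw [show 2 * N - (t + 1) + 1 = 2 * N - t by omega,
        show a - 1 - (r + 1) + 1 = a - 1 - r by omega] at h3
      omega

/-- The chain of the first half of the diagonal slices. -/
def sliceChain (a b c N : ℕ) (P : Finset (ℕ × ℕ × ℕ)) : Fin (N + 1) → Fin a → Fin (b + 1) :=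
  fun t r => ⟨diagonalSlice a b c P t r, Nat.lt_succ_of_le (diagonalSlice_le a b c P t r)⟩

theorem isSelfComplementaryChain_sliceChain {a b c N : ℕ} (hN : a + c = 2 * N)
    {P : Finset (ℕ × ℕ × ℕ)} (hP : P ∈ selfCompPlanePartitions a b c) :
    IsSelfComplementaryChain (sliceChain a b c N P) := by
  have h := isDiagonalSystem_diagonalSlice hP
  refine ⟨?_, fun s => ⟨fun r => ?_, fun r r' hr => ?_⟩, ?_, ?_⟩
  · ext r
    exact h.zero r r.isLt
  · have := h.mono s r (by omega) r.isLt
    rw [Fin.le_def]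
    simpa [sliceChain] using this
  · have := h.interlace s r (by omega) (by omega)
    rw [Fin.le_def]
    simpa [sliceChain, hr] using this
  · cases a with
    | zero => exact fun r => r.elim0
    | succ a =>
      refine Fin.monotone_iff_le_succ.mpr fun r => ?_
      -- The middle partition is increasing because both neighbouring entries are compared through
      -- the diagonal `N + 1`.
      have h1 := h.mono N r (by omega) (by omega)
      have h2 := h.interlace N r (by omega) (by omega)
      rw [Fin.le_def]
      simpa [sliceChain] using h1.trans h2
  · intro r r' hr
    have := h.reflect N N r r' (by omega) hr
    simpa [sliceChain] using this

/-! ### The sign of a plane partition in terms of its chain. -/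

theorem card_sdiff_halfFull_eq_sum {α b c N : ℕ} (hN : 2 * α + c = 2 * N)
    {P : Finset (ℕ × ℕ × ℕ)} (hP : P ⊆ cubeBox (2 * α) b c) :
    halfOrbitCount (2 * α) b c P =
      ∑ x ∈ Finset.range α ×ˢ Finset.range (2 * N + 1),
        ((Finset.Icc 1 b).filter fun j =>
          (2 * α - x.1, j, 2 * α + c - x.1 - x.2) ∈ P).card := by
  have hmem : ∀ i j k, (i, j, k) ∈ P \ halfFull (2 * α) b c ↔ (i, j, k) ∈ P ∧ α < i := by
    intro i j k
    rw [Finset.mem_sdiff, halfFull, Finset.mem_filter]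
    simp only [Nat.mul_div_cancel_left α (show 0 < 2 by omega)]
    constructor
    · rintro ⟨h1, h2⟩
      refine ⟨h1, ?_⟩
      by_contra h3
      exact h2 ⟨hP h1, by omega⟩
    · rintro ⟨h1, h2⟩
      exact ⟨h1, fun h3 => by omega⟩
  rw [halfOrbitCount, Finset.card_eq_sum_card_fiberwise
    (f := fun p : ℕ × ℕ × ℕ => (2 * α - p.1, c + p.1 - p.2.2))
    (t := Finset.range α ×ˢ Finset.range (2 * N + 1))]
  · refine Finset.sum_congr rfl fun x hx => ?_
    rw [Finset.mem_product, Finset.mem_range, Finset.mem_range] at hx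
    refine Finset.card_nbij' (fun p => p.2.1)
      (fun j => (2 * α - x.1, j, 2 * α + c - x.1 - x.2)) ?_ ?_ ?_ ?_
    · rintro ⟨i, j, k⟩ h
      rw [Finset.mem_coe, Finset.mem_filter, hmem, Prod.ext_iff] at h
      have hb := mem_cubeBox.mp (hP h.1.1)
      simp only at h
      rw [Finset.mem_coe, Finset.mem_filter, Finset.mem_Icc,
        show 2 * α - x.1 = i by omega, show 2 * α + c - x.1 - x.2 = k by omega]
      exact ⟨hb.2.1, h.1.1⟩
    · intro j h
      rw [Finset.mem_coe, Finset.mem_filter] at h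
      have hb := mem_cubeBox.mp (hP h.2)
      rw [Finset.mem_coe, Finset.mem_filter, hmem, Prod.ext_iff]
      refine ⟨⟨h.2, by omega⟩, ?_, ?_⟩
      · simp only; omega
      · simp only; omega
    · rintro ⟨i, j, k⟩ h
      rw [Finset.mem_coe, Finset.mem_filter, hmem, Prod.ext_iff] at h
      have hb := mem_cubeBox.mp (hP h.1.1)
      simp only at h
      simp only [Prod.mk.injEq, true_and]
      omega
    · intro j h
      rfl
  · rintro ⟨i, j, k⟩ h
    rw [Finset.mem_coe, hmem] at h
    have hb := mem_cubeBox.mp (hP h.1)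
    simp only [Finset.coe_product, Finset.coe_range, Set.mem_prod, Set.mem_Iio]
    omega

theorem neg_one_pow_halfOrbitCount {α β c N : ℕ} (hN : 2 * α + c = 2 * N)
    {P : Finset (ℕ × ℕ × ℕ)} (hP : P ⊆ cubeBox (2 * α) (2 * β) c) :
    (-1 : ℤ) ^ halfOrbitCount (2 * α) (2 * β) c P =
      ∏ r ∈ Finset.range α, ∏ t ∈ Finset.range (2 * N + 1),
        (-1) ^ diagonalSlice (2 * α) (2 * β) c P t r := by
  rw [card_sdiff_halfFull_eq_sum hN hP, ← Finset.prod_pow_eq_pow_sum, Finset.prod_product]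
  refine Finset.prod_congr rfl fun r _ => Finset.prod_congr rfl fun t _ => ?_
  by_cases h : 2 * α + c - r - t = 0
  · have h1 : (Finset.Icc 1 (2 * β)).filter (fun j =>
        (2 * α - r, j, 2 * α + c - r - t) ∈ P) = ∅ := by
      rw [Finset.filter_eq_empty_iff]
      intro j _ hj
      have := mem_cubeBox.mp (hP hj)
      omega
    rw [h1, diagonalSlice]
    simp [h]
  -- Only positions below the box are counted differently; in the case above they have height `2 *
  -- β`, which is even and leaves the sign unchanged.
  · simp [diagonalSlice, h]

theorem prod_range_two_mul_add_one {M : Type*} [CommMonoid M] (f : ℕ → M) (N : ℕ) :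
    ∏ t ∈ Finset.range (2 * N + 1), f t =
      (∏ t ∈ Finset.range N, f t) * f N * ∏ t ∈ Finset.range N, f (2 * N - t) := by
  rw [show 2 * N + 1 = N + (N + 1) by ring, Finset.prod_range_add, Finset.prod_range_succ',
    mul_comm _ (f (N + 0)), ← mul_assoc, add_zero]
  congr 1
  rw [← Finset.prod_range_reflect]
  refine Finset.prod_congr rfl fun t ht => ?_
  rw [Finset.mem_range] at ht
  congr 1
  omega

/-- A reflection invariant function has the same product over two halves of a grid. -/
theorem prod_half_grid {M : Type*} [CommMonoid M] (α N : ℕ) (f : ℕ → ℕ → M)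
    (hf : ∀ t t' r r', t + t' = 2 * N → r + r' + 1 = 2 * α → f t r = f t' r') :
    ∏ r ∈ Finset.range α, ∏ t ∈ Finset.range (2 * N + 1), f t r =
      (∏ i ∈ Finset.range α, f N (α + i)) *
        ∏ t ∈ Finset.range N, ∏ r ∈ Finset.range (2 * α), f t r := by
  have hflip : ∀ t t', t + t' = 2 * N →
      ∏ r ∈ Finset.range α, f t r = ∏ i ∈ Finset.range α, f t' (α + i) := by
    intro t t' ht
    rw [← Finset.prod_range_reflect]
    refine Finset.prod_congr rfl fun r hr => ?_
    rw [Finset.mem_range] at hr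
    exact hf _ _ _ _ ht (by omega)
  -- The reflection carries the lower rows of the diagonals after `N` to the upper rows of those
  -- before `N`, and swaps the two halves of diagonal `N`.
  simp_rw [prod_range_two_mul_add_one, Finset.prod_mul_distrib]
  rw [hflip N N (by ring), mul_comm (∏ r ∈ Finset.range α, ∏ t ∈ Finset.range N, f t r), mul_assoc]
  congr 1
  rw [Finset.prod_comm, Finset.prod_comm (s := Finset.range α), ← Finset.prod_mul_distrib]
  refine Finset.prod_congr rfl fun t ht => ?_
  rw [Finset.mem_range] at ht
  rw [two_mul α, Finset.prod_range_add]
  congr 1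
  exact hflip _ _ (by omega)

/-- The sign of a chain. -/
def chainSign {α b N : ℕ} (S : Fin (N + 1) → Fin (2 * α) → Fin (b + 1)) : ℤ :=
  (-1) ^ (∑ i : Fin α, (S (Fin.last N) ⟨α + i.val, by omega⟩).val) *
    ∏ s : Fin N, (-1) ^ (∑ r, (S s.castSucc r).val)

theorem neg_one_pow_halfOrbitCount_eq_chainSign {α β c N : ℕ} (hN : 2 * α + c = 2 * N)
    {P : Finset (ℕ × ℕ × ℕ)} (hP : P ∈ selfCompPlanePartitions (2 * α) (2 * β) c) :
    (-1 : ℤ) ^ halfOrbitCount (2 * α) (2 * β) c P =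
      chainSign (sliceChain (2 * α) (2 * β) c N P) := by
  rw [neg_one_pow_halfOrbitCount hN (mem_selfCompPlanePartitions.mp hP).1,
    prod_half_grid α N fun t r => (-1 : ℤ) ^ diagonalSlice (2 * α) (2 * β) c P t r]
  · rw [chainSign, ← Finset.prod_pow_eq_pow_sum]
    simp_rw [← Finset.prod_pow_eq_pow_sum]
    rw [Finset.prod_range, Finset.prod_range]
    simp_rw [Finset.prod_range]
    simp [sliceChain]
  · intro t t' r r' ht hr
    have h := (isDiagonalSystem_diagonalSlice hP).reflect t t' r r' (by omega) hr
    refine neg_one_pow_congr ?_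
    rw [Nat.even_iff, Nat.even_iff]
    omega

/-! ### Bijection with chains and conclusion. -/

open Classical in
theorem signedSelfCompEnum_eq_sum_chainSign (α β c N : ℕ) (hN : 2 * α + c = 2 * N) :
    signedSelfCompEnum (2 * α) (2 * β) c =
      ∑ S : Fin (N + 1) → Fin (2 * α) → Fin (2 * β + 1) with IsSelfComplementaryChain S,
        chainSign S := by
  rw [signedSelfCompEnum]
  refine Finset.sum_bij' (fun P _ => sliceChain (2 * α) (2 * β) c N P)
    (fun S _ => cubesOfDiagonals (2 * α) (2 * β) c (chainExtension c S)) ?_ ?_ ?_ ?_ ?_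
  · intro P hP
    rw [Finset.mem_filter]
    exact ⟨Finset.mem_univ _, isSelfComplementaryChain_sliceChain hN hP⟩
  · intro S hS
    rw [Finset.mem_filter] at hS
    exact (isDiagonalSystem_chainExtension hN hS.2).cubesOfDiagonals_mem
  · intro P hP
    have hsys := isDiagonalSystem_diagonalSlice hP
    have hval : ∀ t r, t ≤ 2 * α + c → r < 2 * α →
        chainExtension c (sliceChain (2 * α) (2 * β) c N P) t r =
          diagonalSlice (2 * α) (2 * β) c P t r := by
      intro t r ht hr
      by_cases h : t < N + 1
      · rw [chainExtension_of_le _ h hr]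
        rfl
      · rw [chainExtension_of_gt _ h (by omega) hr]
        have := hsys.reflect t (2 * α + c - t) r (2 * α - 1 - r) (by omega) (by omega)
        simp only [sliceChain]
        omega
    obtain ⟨hbox, hpp, -⟩ := mem_selfCompPlanePartitions.mp hP
    ext ⟨i, j, k⟩
    rw [cubesOfDiagonals, Finset.mem_filter]
    constructor
    · rintro ⟨h1, h2⟩
      have hb := mem_cubeBox.mp h1
      rw [hval _ _ (by simp only; omega) (by simp only; omega)] at h2
      exact (mem_iff_le_diagonalSlice hpp h1).mpr h2
    · intro h
      have h1 := hbox h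
      have hb := mem_cubeBox.mp h1
      refine ⟨h1, ?_⟩
      rw [hval _ _ (by simp only; omega) (by simp only; omega)]
      exact (mem_iff_le_diagonalSlice hpp h1).mp h
  · intro S hS
    rw [Finset.mem_filter] at hS
    ext t r
    have h := (isDiagonalSystem_chainExtension hN hS.2).diagonalSlice_cubesOfDiagonals
      (t := t) (r := r) (by omega) r.isLt
    rw [chainExtension_of_le S t.isLt r.isLt] at h
    exact h
  · intro P hP
    exact neg_one_pow_halfOrbitCount_eq_chainSign hN hP

open Classical in
theorem sum_chainSign_eq_sum_selfComplementaryShape (α β N : ℕ) :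
    ∑ S : Fin (N + 1) → Fin (2 * α) → Fin (2 * β + 1) with IsSelfComplementaryChain S,
        chainSign S =
      ∑ ν : Fin (2 * α) → Fin (2 * β + 1) with IsSelfComplementaryShape ν,
        (-1) ^ (∑ i : Fin α, (ν ⟨α + i.val, by omega⟩).val) *
          signedChainSum (2 * α) (2 * β) N ν := by
  -- The condition on the last partition and its sign form the endpoint weight; the remaining
  -- conditions are built into the vanishing of `stepSign` and of the initial vector.
  have h := sum_paths_eq_sum_iterate (stepSign (a := 2 * α) (b := 2 * β))
    (signedChainSum (2 * α) (2 * β)) (fun t y => rfl) N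
    (fun ν => if IsSelfComplementaryShape ν then
      (-1) ^ (∑ i : Fin α, (ν ⟨α + i.val, by omega⟩).val) else 0)
  rw [Finset.sum_filter, Finset.sum_filter]
  simp_rw [ite_mul, zero_mul] at h
  rw [← h]
  refine Finset.sum_congr rfl fun S _ => ?_
  by_cases h1 : IsSelfComplementaryShape (S (Fin.last N))
  · by_cases h2 : S 0 = 0
    · by_cases h3 : ∀ s : Fin N, Interlaces (S s.castSucc) (S s.succ)
      · rw [if_pos ⟨h2, h3, h1⟩, if_pos h1, signedChainSum, if_pos h2, one_mul, chainSign]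
        congr 1
        refine Finset.prod_congr rfl fun s _ => ?_
        rw [stepSign, if_pos (h3 s)]
      · rw [if_neg fun hc => h3 hc.2.1, if_pos h1]
        push Not at h3
        obtain ⟨s, hs⟩ := h3
        rw [Finset.prod_eq_zero (Finset.mem_univ s) (by rw [stepSign, if_neg hs])]
        simp
    · rw [if_neg fun hc => h2 hc.1, if_pos h1, signedChainSum, if_neg h2]
      simp
  · rw [if_neg fun hc => h1 hc.2.2, if_neg h1]

theorem theorem6 (a b c : ℕ) (ha : Even a) (hb : Even b) (hc : Even c) :
    (signedSelfCompEnum a b c : ℚ) = macMahonBox (a / 2) (b / 2) (c / 2) := by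
  obtain ⟨α, rfl⟩ := ha.two_dvd
  obtain ⟨β, rfl⟩ := hb.two_dvd
  obtain ⟨γ, rfl⟩ := hc.two_dvd
  rw [signedSelfCompEnum_eq_sum_chainSign α β (2 * γ) (α + γ) (by ring),
    sum_chainSign_eq_sum_selfComplementaryShape, sum_selfComplementaryShape_eq_macMahonBox]
  simp
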